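/- Let $G$ be a finite group, $k$ a field, and $\beta\in Z^3(G,k^*)$ a normalized 3-cocycle ($\beta(g,h,l)=1$ as soon as one argument is $1$). Put $$\theta_g(x,y)=\frac{\beta(g,x,y)\,\beta(x,y,(xy)^{-1}gxy)}{\beta(x,x^{-1}gx,y)},\qquad \gamma_x(g,h)=\frac{\beta(g,h,x)\,\beta(x,x^{-1}gx,x^{-1}hx)}{\beta(g,x,x^{-1}hx)} .$$ The twisted Drinfel'd double $D^\beta(k[G])$ has basis $g\lfloor x$ ($g,x\in G$), product $(g\lfloor x)(h\lfloor y)=\delta_{g,xhx^{-1}}\theta_g(x,y)\,g\lfloor xy$, unit $\sum_g g\lfloor 1$, coproduct $\Delta(g\lfloor x)=\sum_{g_1g_2=g}\gamma_x(g_1,g_2)\,g_1\lfloor x\otimes g_2\lfloor x$, counit $\varepsilon(g\lfloor x)=\delta_{g,1}$, associator $\Phi=\sum\beta(g,h,l)^{-1}\,g\lfloor 1\otimes h\lfloor 1\otimes l\lfloor 1$ and $R=\sum_{g,h} g\lfloor 1\otimes h\lfloor g$. Its finite-dimensional modules form a braided monoidal category $\mathrm{Rep}(D^\beta(k[G]))$: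 the algebra acts on $U\otimes V$ through $\Delta$ and on the unit object $k$ through $\varepsilon$, the associativity constraint is $(u\otimes v)\otimes w\mapsto\Phi\,(u\otimes(v\otimes w))$, and the braiding is $R$ followed by the flip. A $\beta$-twisted bundle on the inertia stack of $[pt/G]$, $\coprod_{[g]}[pt/Z(g)]$, is a family $F$ of finite-dimensional $\theta_g$-twisted representations of the centralizers $Z(g)$, one for each conjugacy class $[g]$. The product of two such bundles is the push-pull product: on the sector of $h$, $$(F\cdot F')_h=\bigoplus_{[m_1,m_2],\ m_1m_2=h}\mathrm{Ind}_{Z(m_1,m_2)}^{Z(h)}\bigl(F_{m_1}|_{Z(m_1,m_2)}\otimes^\gamma F'_{m_2}|_{Z(m_1,m_2)}\bigr),$$ where the sum is over the pairs with $m_1m_2=h$ up to simultaneous conjugation, $Z(m_1,m_2)$ is the common centralizer, and $x$ acts on $\otimes^\gamma$ by $\gamma_x(m_1,m_2)\,\rho(x)\otimes\rho'(x)$. The $\beta$-twisted full K-theory $K^\beta_{\rm full}([pt/G])$ is the Grothendieck group (with respect to short exact sequences) of these bundles with the induced product; its unit is the class of the trivial line bundle on the sector of $1$. The representation ring of $D^\beta(k[G])$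 is the Grothendieck group of $\mathrm{Rep}(D^\beta(k[G]))$ with the product induced by $\otimes$. Then: 1. The category of $\beta$-twisted bundles on the inertia stack of $[pt/G]$ carries a braided monoidal structure whose tensor product functor is naturally isomorphic to the push-pull product and whose unit is isomorphic to the trivial line bundle on the sector of $1$, and there is a $k$-linear braided monoidal equivalence $E$ from it to $\mathrm{Rep}(D^\beta(k[G]))$. 2. $E$ induces an isomorphism $K^\beta_{\rm full}([pt/G])\cong \mathrm{Rep}(D^\beta(k[G]))$ of the Grothendieck groups that respects products and units: $[F]\mapsto[E(F)]$. 3. Associativity and commutativity hold in the braided monoidal sense, with associator given by $\beta$: for homogeneous $u_g,v_h,w_l$ in $D^\beta(k[G])$-modules (where $u_g$ has degree $g$ if $(g\lfloor 1)u_g=u_g$), the associativity constraint is $(u_g\otimes v_h)\otimes w_l\mapsto\beta(g,h,l)^{-1}\,u_g\otimes(v_h\otimes w_l)$, and for every vector $v$ the braiding is $u_g\otimes v\mapsto\bigl(\sum_h h\lfloor g\bigr)v\otimes u_g$. The associativity constraint is the canonical rebracketing for all modules if and only if $\beta\equiv1$. -/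

import Mathlib

open scoped TensorProduct
open CategoryTheory MonoidalCategory
universe u

section TwistedDoubleDefs

/-- A normalized 3-cocycle of the group `G` with values in the (trivial `G`-module) `kˣ`. -/
structure NormalizedCocycle (G k : Type u) [Group G] [Field k] where
  toFun : G → G → G → kˣ
  cocycle : ∀ g h x y,
    toFun h x y * toFun g (h * x) y * toFun g h x = toFun (g * h) x y * toFun g h (x * y)
  one_left : ∀ h x, toFun 1 h x = 1
  one_middle : ∀ g x, toFun g 1 x = 1
  one_right : ∀ g h, toFun g h 1 = 1

namespace NormalizedCocycle
variable {G k : Type u} [Group G] [Field k] (β : NormalizedCocycle G k)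

/-- `θ_g(x,y) = β(g,x,y) β(x,y,(xy)⁻¹g(xy)) / β(x,x⁻¹gx,y)`. -/
def θ (g x y : G) : kˣ :=
  β.toFun g x y * β.toFun x y ((x * y)⁻¹ * g * (x * y)) / β.toFun x (x⁻¹ * g * x) y

/-- `γ_x(g₁,g₂) = β(g₁,g₂,x) β(x,x⁻¹g₁x,x⁻¹g₂x) / β(g₁,x,x⁻¹g₂x)`. -/
def γ (x g h : G) : kˣ :=
  β.toFun g h x * β.toFun x (x⁻¹ * g * x) (x⁻¹ * h * x) / β.toFun g x (x⁻¹ * h * x)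

theorem θ_cocycle (g x y z : G) :
    β.θ g x y * β.θ g (x * y) z = β.θ g x (y * z) * β.θ (x⁻¹ * g * x) y z := by
  have h1 := congrArg Additive.ofMul (β.cocycle g x y z)
  have h2 := congrArg Additive.ofMul (β.cocycle x (x⁻¹ * g * x) y z)
  have h3 := congrArg Additive.ofMul (β.cocycle x y ((x * y)⁻¹ * g * (x * y)) z)
  have h4 := congrArg Additive.ofMul (β.cocycle x y z ((x * y * z)⁻¹ * g * (x * y * z)))
  apply Additive.ofMul.injective
  simp only [θ, ofMul_mul, ofMul_div, mul_assoc, mul_inv_rev, mul_inv_cancel_left,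
    inv_mul_cancel_left] at h1 h2 h3 h4 ⊢
  linear_combination (norm := abel) h1 - h2 + h3 - h4

theorem γ_θ (g h x y : G) :
    β.γ x g h * β.γ y (x⁻¹ * g * x) (x⁻¹ * h * x) * (β.θ g x y * β.θ h x y) =
      β.θ (g * h) x y * β.γ (x * y) g h := by
  have h1 := congrArg Additive.ofMul (β.cocycle g h x y)
  have h2 := congrArg Additive.ofMul (β.cocycle g x (x⁻¹ * h * x) y)
  have h3 := congrArg Additive.ofMul (β.cocycle g x y ((x * y)⁻¹ * h * (x * y)))
  have h4 := congrArg Additive.ofMul (β.cocycle x (x⁻¹ * g * x) (x⁻¹ * h * x) y)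
  have h5 := congrArg Additive.ofMul (β.cocycle x (x⁻¹ * g * x) y ((x * y)⁻¹ * h * (x * y)))
  have h6 := congrArg Additive.ofMul
    (β.cocycle x y ((x * y)⁻¹ * g * (x * y)) ((x * y)⁻¹ * h * (x * y)))
  apply Additive.ofMul.injective
  simp only [θ, γ, ofMul_mul, ofMul_div, mul_assoc, mul_inv_rev, mul_inv_cancel_left,
    inv_mul_cancel_left] at h1 h2 h3 h4 h5 h6 ⊢
  linear_combination (norm := abel) h1 - h2 + h3 + h4 - h5 + h6

theorem γ_assoc (x g h l : G) :
    (β.toFun g h l)⁻¹ * (β.γ x g h * β.γ x (g * h) l) =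
      β.γ x h l * β.γ x g (h * l) *
        (β.toFun (x⁻¹ * g * x) (x⁻¹ * h * x) (x⁻¹ * l * x))⁻¹ := by
  have h1 := congrArg Additive.ofMul (β.cocycle g h l x)
  have h2 := congrArg Additive.ofMul (β.cocycle g h x (x⁻¹ * l * x))
  have h3 := congrArg Additive.ofMul (β.cocycle g x (x⁻¹ * h * x) (x⁻¹ * l * x))
  have h4 := congrArg Additive.ofMul
    (β.cocycle x (x⁻¹ * g * x) (x⁻¹ * h * x) (x⁻¹ * l * x))
  apply Additive.ofMul.injective
  simp only [γ, ofMul_mul, ofMul_div, ofMul_inv, mul_assoc, mul_inv_rev, mul_inv_cancel_left,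
    inv_mul_cancel_left] at h1 h2 h3 h4 ⊢
  linear_combination (norm := abel) h2 - h1 - h3 + h4

@[simp] theorem θ_one_left (g y : G) : β.θ g 1 y = 1 := by
  simp [θ, β.one_left, β.one_middle]

@[simp] theorem θ_one_right (g x : G) : β.θ g x 1 = 1 := by
  simp [θ, β.one_right, β.one_middle]

@[simp] theorem θ_one (x y : G) : β.θ 1 x y = 1 := by
  simp [θ, β.one_left, β.one_right, β.one_middle]

@[simp] theorem γ_one (g h : G) : β.γ 1 g h = 1 := by
  simp [γ, β.one_left, β.one_right, β.one_middle]

@[simp] theorem γ_one_left (x h : G) : β.γ x 1 h = 1 := by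
  simp [γ, β.one_left, β.one_middle]

@[simp] theorem γ_one_right (x g : G) : β.γ x g 1 = 1 := by
  simp [γ, β.one_right, β.one_middle]

theorem γ_braid (x g h : G) :
    β.γ x (x * g * x⁻¹) (x * h * x⁻¹) * β.θ (x * g * h * (x * g)⁻¹) (x * g * x⁻¹) x =
      β.γ x (x * (g * h * g⁻¹) * x⁻¹) (x * g * x⁻¹) * β.θ (x * g * h * (x * g)⁻¹) x g := by
  apply Additive.ofMul.injective
  simp only [θ, γ, ofMul_mul, ofMul_div, mul_assoc, mul_inv_rev, mul_inv_cancel_left,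
    inv_mul_cancel_left, inv_mul_cancel, mul_inv_cancel, mul_one, inv_inv]
  abel

theorem θ_hexagon (g h l : G) :
    β.γ g (g * h * g⁻¹) (g * l * g⁻¹) * β.toFun (g * h * g⁻¹) g l =
      β.toFun (g * h * g⁻¹) (g * l * g⁻¹) g * β.toFun g h l := by
  apply Additive.ofMul.injective
  simp only [θ, γ, ofMul_mul, ofMul_div, mul_assoc, mul_inv_rev, mul_inv_cancel_left,
    inv_mul_cancel_left, inv_mul_cancel, mul_inv_cancel, mul_one, inv_inv]
  abel

theorem θ_hexagon' (g h l : G) :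
    β.θ (g * h * l * (g * h)⁻¹) g h * β.toFun g (h * l * h⁻¹) h =
      β.toFun (g * h * l * (g * h)⁻¹) g h * β.toFun g h l := by
  apply Additive.ofMul.injective
  simp only [θ, γ, ofMul_mul, ofMul_div, mul_assoc, mul_inv_rev, mul_inv_cancel_left,
    inv_mul_cancel_left, inv_mul_cancel, mul_inv_cancel, mul_one, inv_inv]
  abel

end NormalizedCocycle

variable {G k : Type u} [Group G] [Field k]

/-- The twisted Drinfel'd double `D^β(k[G])`: the vector space with basis indexed by pairs
`(g, x)`; the product, coproduct, counit, associator and `R`-matrix follow. -/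
def TwistedDouble (_β : NormalizedCocycle G k) : Type u := G × G →₀ k

namespace TwistedDouble
variable (β : NormalizedCocycle G k)

noncomputable instance : AddCommGroup (TwistedDouble β) := inferInstanceAs (AddCommGroup (G × G →₀ k))

noncomputable instance : Module k (TwistedDouble β) := inferInstanceAs (Module k (G × G →₀ k))

noncomputable def basis : Module.Basis (G × G) k (TwistedDouble β) :=
  (Finsupp.basisSingleOne : Module.Basis (G × G) k (G × G →₀ k))

/-- The basis element with indices `g` and `x` (written `g ⌊ x`). -/
noncomputable def elt (g x : G) : TwistedDouble β := basis β (g, x)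

variable {β} in
theorem induction {p : TwistedDouble β → Prop} (a : TwistedDouble β)
    (zero : p 0) (add : ∀ a b, p a → p b → p (a + b)) (smul : ∀ (c : k) g x, p (c • elt β g x)) :
    p a := by
  refine Finsupp.induction_linear (motive := p) a zero (fun f g hf hg => add f g hf hg) ?_
  intro q c
  have : (Finsupp.single q c : G × G →₀ k) = c • elt β q.1 q.2 := by
    simp [elt, basis]
    exact (Finsupp.smul_single_one q c).symm
  rw [this]
  exact smul c q.1 q.2

open Classical in
/-- The product `(g ⌊ x)(h ⌊ y) = δ_{g, xhx⁻¹} θ_g(x,y) (g ⌊ xy)`, extended bilinearly. -/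
noncomputable def mulLin : TwistedDouble β →ₗ[k] TwistedDouble β →ₗ[k] TwistedDouble β :=
  (basis β).constr k fun p => (basis β).constr k fun q =>
    if p.1 = p.2 * q.1 * p.2⁻¹ then (β.θ p.1 p.2 q.2 : k) • elt β p.1 (p.2 * q.2) else 0

noncomputable instance : Mul (TwistedDouble β) := ⟨fun a b => mulLin β a b⟩

theorem mul_def (a b : TwistedDouble β) : a * b = mulLin β a b := rfl

open Classical in
theorem elt_mul_elt (g x h y : G) : elt β g x * elt β h y =
    if g = x * h * x⁻¹ then (β.θ g x y : k) • elt β g (x * y) else 0 := by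
  change mulLin β (basis β (g, x)) (basis β (h, y)) = _
  simp [mulLin]

noncomputable instance : NonUnitalNonAssocRing (TwistedDouble β) :=
  { (inferInstance : AddCommGroup (TwistedDouble β)), (inferInstance : Mul (TwistedDouble β)) with
    left_distrib := fun a b c => (mulLin β a).map_add b c
    right_distrib := fun a b c => by
      change mulLin β (a + b) c = mulLin β a c + mulLin β b c
      simp
    zero_mul := fun a => by change mulLin β 0 a = 0; simp
    mul_zero := fun a => by change mulLin β a 0 = 0; simp }

theorem smul_mul' (c : k) (a b : TwistedDouble β) : (c • a) * b = c • (a * b) := by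
  simp [mul_def]

theorem mul_smul' (c : k) (a b : TwistedDouble β) : a * (c • b) = c • (a * b) := by
  simp [mul_def]

theorem elt_assoc (g x h y l z : G) :
    elt β g x * elt β h y * elt β l z = elt β g x * (elt β h y * elt β l z) := by
  classical
  have e : g = x * h * x⁻¹ → (g = (x * y) * l * (x * y)⁻¹ ↔ h = y * l * y⁻¹) := by
    rintro rfl
    constructor
    · intro e
      have := congrArg (fun t => x⁻¹ * t * x) e
      simpa [mul_assoc] using this
    · rintro rfl
      simp [mul_assoc]
  rw [elt_mul_elt, elt_mul_elt]
  by_cases h1 : g = x * h * x⁻¹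
  · by_cases h2 : h = y * l * y⁻¹
    · have h3 := (e h1).2 h2
      have h4 : x⁻¹ * g * x = h := by simp [h1, mul_assoc]
      rw [if_pos h1, if_pos h2, smul_mul', mul_smul', elt_mul_elt, elt_mul_elt, if_pos h3,
        if_pos h1, smul_smul, smul_smul, mul_assoc x y z]
      have := β.θ_cocycle g x y z
      rw [h4] at this
      rw [← Units.val_mul, ← Units.val_mul, this, mul_comm]
    · have h3 := fun h => h2 ((e h1).1 h)
      rw [if_pos h1, if_neg h2, smul_mul', elt_mul_elt, if_neg h3, smul_zero, mul_zero]
  · by_cases h2 : h = y * l * y⁻¹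
    · rw [if_neg h1, if_pos h2, mul_smul', elt_mul_elt, if_neg h1, smul_zero, zero_mul]
    · rw [if_neg h1, if_neg h2, zero_mul, mul_zero]

variable [Fintype G]

/-- The unit is `∑_g g ⌊ 1`. -/
noncomputable instance : One (TwistedDouble β) := ⟨∑ g, elt β g 1⟩

theorem one_def : (1 : TwistedDouble β) = ∑ g, elt β g 1 := rfl

noncomputable instance : Ring (TwistedDouble β) :=
  { (inferInstance : NonUnitalNonAssocRing (TwistedDouble β)),
    (inferInstance : One (TwistedDouble β)) with
    mul_assoc := fun a b c => by
      induction a using induction with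
      | zero => simp
      | add a a' h h' => simp only [add_mul, h, h']
      | smul r g x =>
        induction b using induction with
        | zero => simp
        | add a a' h h' => simp only [add_mul, mul_add, h, h']
        | smul r g x =>
          induction c using induction with
          | zero => simp
          | add a a' h h' => simp only [mul_add, h, h']
          | smul r g x => simp only [smul_mul', mul_smul', elt_assoc]
    one_mul := fun a => by
      classical
      induction a using induction with
      | zero => simp
      | add a a' h h' => simp only [mul_add, h, h']
      | smul r g x => simp [one_def, mul_smul', Finset.sum_mul, elt_mul_elt]
    mul_one := fun a => by
      classical
      induction a using induction with
      | zero => simp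
      | add a a' h h' => simp only [add_mul, h, h']
      | smul r g x =>
        have : ∀ h : G, (g = x * h * x⁻¹) ↔ h = x⁻¹ * g * x := fun h =>
          ⟨fun e => by simp [e, mul_assoc], fun e => by simp [e, mul_assoc]⟩
        simp [one_def, smul_mul', Finset.mul_sum, elt_mul_elt, this] }

noncomputable instance : Algebra k (TwistedDouble β) :=
  Algebra.ofModule (smul_mul' β) (mul_smul' β)

/-- The coproduct `Δ(g ⌊ x) = ∑_{g₁g₂ = g} γ_x(g₁,g₂) (g₁ ⌊ x) ⊗ (g₂ ⌊ x)`; the sum is indexed by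
`g₁ = h`, `g₂ = h⁻¹g`. -/
noncomputable def comulLin :
    TwistedDouble β →ₗ[k] TwistedDouble β ⊗[k] TwistedDouble β :=
  (basis β).constr k fun p =>
    ∑ h : G, (β.γ p.2 h (h⁻¹ * p.1) : k) • (elt β h p.2 ⊗ₜ[k] elt β (h⁻¹ * p.1) p.2)

theorem comulLin_elt (g x : G) : comulLin β (elt β g x) =
    ∑ h : G, (β.γ x h (h⁻¹ * g) : k) • (elt β h x ⊗ₜ[k] elt β (h⁻¹ * g) x) := by
  change comulLin β (basis β (g, x)) = _
  rw [comulLin, Module.Basis.constr_basis]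

/-- The coproduct as an algebra homomorphism. -/
noncomputable def comul :
    TwistedDouble β →ₐ[k] TwistedDouble β ⊗[k] TwistedDouble β :=
  AlgHom.ofLinearMap (comulLin β)
    (by
      simp only [one_def, map_sum, comulLin_elt, NormalizedCocycle.γ_one,
        Algebra.TensorProduct.one_def, TensorProduct.sum_tmul, TensorProduct.tmul_sum,
        Units.val_one, one_smul]
      rw [Finset.sum_comm]
      conv_rhs => rw [Finset.sum_comm]
      refine Finset.sum_congr rfl fun h _ => ?_
      exact Fintype.sum_equiv (Equiv.mulLeft h⁻¹) _ _ fun g => rfl)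
    (by
      have key : ∀ g x h y : G, comulLin β (elt β g x * elt β h y) =
          comulLin β (elt β g x) * comulLin β (elt β h y) := by
        classical
        intro g x h y
        simp only [comulLin_elt, Finset.sum_mul, Finset.mul_sum, smul_mul_assoc, mul_smul_comm,
          Algebra.TensorProduct.tmul_mul_tmul, elt_mul_elt, Finset.smul_sum]
        rw [Finset.sum_comm]
        by_cases e : g = x * h * x⁻¹
        · have e1 : ∀ a b : G, a⁻¹ * g = x * (b⁻¹ * h) * x⁻¹ ↔ a = x * b * x⁻¹ := by
            intro a b
            subst e
            constructor
            · intro e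
              have : a⁻¹ = x * b⁻¹ * x⁻¹ := by
                have := congrArg (fun t => t * (x * h⁻¹ * x⁻¹)) e
                simpa [mul_assoc] using this
              rw [← inv_inj, this]; simp [mul_assoc]
            · rintro rfl; simp [mul_assoc]
          have e2 : ∀ a b : G, a = x * b * x⁻¹ ↔ b = x⁻¹ * a * x := fun a b =>
            ⟨fun e => by simp [e, mul_assoc], fun e => by simp [e, mul_assoc]⟩
          simp only [if_pos e, e1]
          rw [map_smul, comulLin_elt, Finset.smul_sum]
          refine Finset.sum_congr rfl fun a _ => ?_
          have e3 : ∀ b : G, (β.γ x a (a⁻¹ * g) : k) • (β.γ y b (b⁻¹ * h) : k) •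
              ((if a = x * b * x⁻¹ then (β.θ a x y : k) • elt β a (x * y) else 0) ⊗ₜ[k]
              (if a = x * b * x⁻¹ then (β.θ (a⁻¹ * g) x y : k) • elt β (a⁻¹ * g) (x * y) else 0))
              = if b = x⁻¹ * a * x then (β.θ g x y : k) • (β.γ (x * y) a (a⁻¹ * g) : k) •
                (elt β a (x * y) ⊗ₜ[k] elt β (a⁻¹ * g) (x * y)) else 0 := by
            intro b
            by_cases hb : b = x⁻¹ * a * x
            · have hb' := (e2 a b).2 hb
              simp only [if_pos hb, if_pos hb', TensorProduct.smul_tmul_smul, smul_smul]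
              congr 1
              have h1 := β.γ_θ a (a⁻¹ * g) x y
              have h2 : b⁻¹ * h = x⁻¹ * (a⁻¹ * g) * x := by
                subst hb; subst e; simp [mul_assoc]
              rw [h2, hb]
              rw [mul_inv_cancel_left] at h1
              simpa only [Units.val_mul, mul_assoc] using congrArg Units.val h1
            · have hb' := fun h => hb ((e2 a b).1 h)
              simp [if_neg hb, if_neg hb']
          simp only [smul_comm (β.γ y _ _ : k), e3]
          simp [e3]
        · rw [if_neg e, map_zero]
          symm
          refine Finset.sum_eq_zero fun a _ => Finset.sum_eq_zero fun b _ => ?_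
          by_cases h1 : a = x * b * x⁻¹
          · have h2 : ¬ (a⁻¹ * g = x * (b⁻¹ * h) * x⁻¹) := by
              intro h2
              apply e
              rw [inv_mul_eq_iff_eq_mul] at h2
              rw [h2, h1]; simp [mul_assoc]
            simp [if_neg h2]
          · simp [if_neg h1]
      intro a b
      induction a using induction with
      | zero => simp
      | add a a' h h' => simp only [add_mul, map_add, h, h']
      | smul r g x =>
        induction b using induction with
        | zero => simp
        | add a a' h h' => simp only [mul_add, map_add, h, h']
        | smul r g x => simp only [smul_mul_assoc, mul_smul_comm, map_smul, key])

theorem comul_elt (g x : G) : comul β (elt β g x) =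
    ∑ h : G, (β.γ x h (h⁻¹ * g) : k) • (elt β h x ⊗ₜ[k] elt β (h⁻¹ * g) x) :=
  comulLin_elt β g x

open Classical in
/-- The counit `ε(g ⌊ x) = δ_{g,1}`. -/
noncomputable def counitLin : TwistedDouble β →ₗ[k] k :=
  (basis β).constr k fun p => if p.1 = 1 then 1 else 0

open Classical in
theorem counitLin_elt (g x : G) : counitLin β (elt β g x) = if g = 1 then 1 else 0 := by
  change counitLin β (basis β (g, x)) = _
  rw [counitLin, Module.Basis.constr_basis]

/-- The counit as an algebra homomorphism. -/
noncomputable def counit : TwistedDouble β →ₐ[k] k :=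
  AlgHom.ofLinearMap (counitLin β) (by classical simp [one_def, counitLin_elt]) (by
    classical
    intro a b
    induction a using induction with
    | zero => simp
    | add a a' h h' => simp only [add_mul, map_add, h, h']
    | smul r g x =>
      induction b using induction with
      | zero => simp
      | add a a' h h' => simp only [mul_add, map_add, h, h']
      | smul r' h y =>
        simp only [smul_mul_assoc, mul_smul_comm, map_smul, counitLin_elt, elt_mul_elt]
        by_cases e : g = 1
        · subst e
          have : (1 = x * h * x⁻¹) ↔ h = 1 := by
            rw [eq_comm, mul_inv_eq_one, mul_eq_left]
          by_cases e : h = 1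
          · simp [e, counitLin_elt]
          · simp [e, this]
        · split_ifs <;> simp [e, counitLin_elt])

/-- The associator `Φ = ∑ β(g,h,l)⁻¹ (g ⌊ 1) ⊗ (h ⌊ 1) ⊗ (l ⌊ 1)`. -/
noncomputable def Φ : TwistedDouble β ⊗[k] (TwistedDouble β ⊗[k] TwistedDouble β) :=
  ∑ g : G, ∑ h : G, ∑ l : G,
    ((β.toFun g h l)⁻¹ : kˣ).val • (elt β g 1 ⊗ₜ[k] (elt β h 1 ⊗ₜ[k] elt β l 1))

/-- The element `𝟏 ⌊ x = ∑_h h ⌊ x`. -/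
noncomputable def sumElt (x : G) : TwistedDouble β := ∑ h : G, elt β h x

/-- The `R`-matrix `R = ∑_g (g ⌊ 1) ⊗ (𝟏 ⌊ g)`. -/
noncomputable def R : TwistedDouble β ⊗[k] TwistedDouble β :=
  ∑ g : G, elt β g 1 ⊗ₜ[k] sumElt β g

end TwistedDouble

/-- A finite-dimensional left `D^β(k[G])`-module. -/
structure RepDouble [Fintype G] (β : NormalizedCocycle G k) where
  V : Type u
  [addCommGroup : AddCommGroup V]
  [module : Module k V]
  [finiteDimensional : FiniteDimensional k V]
  ρ : TwistedDouble β →ₐ[k] Module.End k V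

namespace RepDouble
open TwistedDouble
variable [Fintype G] {β : NormalizedCocycle G k}
attribute [instance] addCommGroup module finiteDimensional

/-- A homomorphism of `D^β(k[G])`-modules. -/
@[ext]
structure Hom (A B : RepDouble β) where
  lin : A.V →ₗ[k] B.V
  comm : ∀ a v, lin (A.ρ a v) = B.ρ a (lin v)

instance : Category (RepDouble β) where
  Hom := Hom
  id A := ⟨LinearMap.id, fun _ _ => rfl⟩
  comp f g := ⟨g.lin ∘ₗ f.lin, fun a v => by simp [f.comm, g.comm]⟩

@[ext]

theorem hom_ext {A B : RepDouble β} {f g : A ⟶ B} (h : f.lin = g.lin) : f = g := Hom.ext h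

@[simp] theorem id_lin (A : RepDouble β) : Hom.lin (𝟙 A) = LinearMap.id := rfl

@[simp] theorem comp_lin {A B C : RepDouble β} (f : A ⟶ B) (g : B ⟶ C) :
    (f ≫ g).lin = g.lin ∘ₗ f.lin := rfl

/-- `v` lies in the degree `g` part `A_g`, the image of the projector `ρ(g ⌊ 1)`. -/
def Homog (A : RepDouble β) (g : G) (v : A.V) : Prop := A.ρ (elt β g 1) v = v

/-- `φ(x) = ρ(𝟏 ⌊ x)`. -/
noncomputable def φ (A : RepDouble β) (x : G) : Module.End k A.V := A.ρ (sumElt β x)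

theorem homog_proj (A : RepDouble β) (g : G) (v : A.V) : A.Homog g (A.ρ (elt β g 1) v) := by
  change (A.ρ _ * A.ρ _) v = _
  rw [← map_mul, elt_mul_elt]
  simp

theorem sum_proj (A : RepDouble β) (v : A.V) : ∑ g : G, A.ρ (elt β g 1) v = v := by
  rw [← LinearMap.sum_apply, ← map_sum, ← one_def, map_one]; rfl

open Classical in
theorem ρ_homog {A : RepDouble β} {h : G} {v : A.V} (hv : A.Homog h v) (g x : G) :
    A.ρ (elt β g x) v = if g = x * h * x⁻¹ then A.φ x v else 0 := by
  have key : ∀ g, A.ρ (elt β g x) v = if g = x * h * x⁻¹ then A.ρ (elt β g x) v else 0 := by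
    intro g
    conv_lhs => rw [← hv]
    change (A.ρ _ * A.ρ _) v = _
    rw [← map_mul, elt_mul_elt]
    split_ifs <;> simp
  rw [key]
  split_ifs with e
  · subst e
    rw [φ, sumElt, map_sum, LinearMap.sum_apply]
    rw [Finset.sum_congr rfl fun g _ => key g]
    simp
  · rfl

theorem homog_proj_eq {A : RepDouble β} {h : G} {v : A.V} (hv : A.Homog h v) [DecidableEq G]
    (g : G) : A.ρ (elt β g 1) v = if g = h then v else 0 := by
  classical
  split_ifs with e
  · rw [e]; exact hv
  · rw [ρ_homog hv, if_neg]
    simpa using e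

theorem homog_φ {A : RepDouble β} {h : G} {v : A.V} (hv : A.Homog h v) (x : G) :
    A.Homog (x * h * x⁻¹) (A.φ x v) := by
  classical
  have := ρ_homog hv (x * h * x⁻¹) x
  rw [if_pos rfl] at this
  rw [← this, Homog]
  change (A.ρ _ * A.ρ _) v = _
  rw [← map_mul, elt_mul_elt]
  simp

theorem φ_φ {A : RepDouble β} {h : G} {v : A.V} (hv : A.Homog h v) (x y : G) :
    A.φ x (A.φ y v) = (β.θ (x * y * h * (x * y)⁻¹) x y : k) • A.φ (x * y) v := by
  classical
  have h1 := ρ_homog hv (y * h * y⁻¹) y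
  have h2 := ρ_homog (homog_φ hv y) (x * (y * h * y⁻¹) * x⁻¹) x
  have h3 := ρ_homog hv (x * y * h * (x * y)⁻¹) (x * y)
  rw [if_pos rfl] at h1 h2 h3
  rw [← h2, ← h1, ← h3]
  change (A.ρ _ * A.ρ _) v = _
  have e : x * (y * h * y⁻¹) * x⁻¹ = x * y * h * (x * y)⁻¹ := by simp [mul_assoc]
  rw [← map_mul, elt_mul_elt, if_pos rfl, e, map_smul]
  rfl

theorem φ_one {A : RepDouble β} (v : A.V) : A.φ 1 v = v := by
  rw [φ, sumElt, ← one_def, map_one]; rfl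

theorem hom_φ {A B : RepDouble β} (f : A ⟶ B) (x : G) (v : A.V) :
    f.lin (A.φ x v) = B.φ x (f.lin v) := f.comm _ _

theorem Homog.map {A B : RepDouble β} (f : A ⟶ B) {g : G} {v : A.V} (h : A.Homog g v) :
    B.Homog g (f.lin v) := by
  rw [Homog, ← f.comm, h]

/-- Linear maps that agree on homogeneous elements agree. -/
theorem lin_ext {A : RepDouble β} {M : Type u} [AddCommGroup M] [Module k M]
    {f f' : A.V →ₗ[k] M} (h : ∀ g v, A.Homog g v → f v = f' v) : f = f' := by
  ext v
  rw [← A.sum_proj v, map_sum, map_sum]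
  exact Finset.sum_congr rfl fun g _ => h g _ (A.homog_proj g v)

theorem lin_ext₂ {A B : RepDouble β} {M : Type u} [AddCommGroup M] [Module k M]
    {f f' : A.V ⊗[k] B.V →ₗ[k] M}
    (h : ∀ g v h w, A.Homog g v → B.Homog h w → f (v ⊗ₜ w) = f' (v ⊗ₜ w)) : f = f' := by
  apply TensorProduct.ext
  refine lin_ext fun g v hv => lin_ext fun h' w hw => ?_
  exact h g v h' w hv hw

theorem lin_ext₃ {A B C : RepDouble β} {M : Type u} [AddCommGroup M] [Module k M]
    {f f' : (A.V ⊗[k] B.V) ⊗[k] C.V →ₗ[k] M}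
    (h : ∀ g v h w l x, A.Homog g v → B.Homog h w → C.Homog l x →
      f ((v ⊗ₜ w) ⊗ₜ x) = f' ((v ⊗ₜ w) ⊗ₜ x)) : f = f' := by
  apply TensorProduct.ext
  refine lin_ext₂ fun g v h' w hv hw => lin_ext fun l x hx => ?_
  exact h g v h' w l x hv hw hx

theorem lin_ext₃' {A B C : RepDouble β} {M : Type u} [AddCommGroup M] [Module k M]
    {f f' : A.V ⊗[k] (B.V ⊗[k] C.V) →ₗ[k] M}
    (h : ∀ g v h w l x, A.Homog g v → B.Homog h w → C.Homog l x →
      f (v ⊗ₜ (w ⊗ₜ x)) = f' (v ⊗ₜ (w ⊗ₜ x))) : f = f' := by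
  apply TensorProduct.ext
  refine lin_ext fun g v hv => lin_ext₂ fun h' w l x hw hx => ?_
  exact h g v h' w l x hv hw hx

theorem lin_ext₄ {A B C D : RepDouble β} {M : Type u} [AddCommGroup M] [Module k M]
    {f f' : ((A.V ⊗[k] B.V) ⊗[k] C.V) ⊗[k] D.V →ₗ[k] M}
    (h : ∀ g v h w l x m y, A.Homog g v → B.Homog h w → C.Homog l x → D.Homog m y →
      f (((v ⊗ₜ w) ⊗ₜ x) ⊗ₜ y) = f' (((v ⊗ₜ w) ⊗ₜ x) ⊗ₜ y)) : f = f' := by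
  apply TensorProduct.ext
  refine lin_ext₃ fun g v h' w l x hv hw hx => lin_ext fun m y hy => ?_
  exact h g v h' w l x m y hv hw hx hy

/-- A linear map that commutes with all basis elements is a homomorphism. -/
def mkHom {A B : RepDouble β} (f : A.V →ₗ[k] B.V)
    (h : ∀ g x v, f (A.ρ (elt β g x) v) = B.ρ (elt β g x) (f v)) : A ⟶ B where
  lin := f
  comm a v := by
    induction a using induction with
    | zero => simp
    | add a b ha hb => simp [ha, hb]
    | smul c g x => simp [h]

/-- The action of `D ⊗ D` on `A ⊗ B`. -/
noncomputable def actTwo (A B : RepDouble β) :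
    TwistedDouble β ⊗[k] TwistedDouble β →ₐ[k] Module.End k (A.V ⊗[k] B.V) :=
  (Module.endTensorEndAlgHom (R := k) (S := k) (A := k)).comp
    (Algebra.TensorProduct.map A.ρ B.ρ)

theorem actTwo_tmul (A B : RepDouble β) (a b : TwistedDouble β) :
    actTwo A B (a ⊗ₜ b) = TensorProduct.map (A.ρ a) (B.ρ b) := rfl

/-- The action of `D ⊗ (D ⊗ D)` on `A ⊗ (B ⊗ C)`. -/
noncomputable def actThree (A B C : RepDouble β) :
    TwistedDouble β ⊗[k] (TwistedDouble β ⊗[k] TwistedDouble β) →ₐ[k]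
      Module.End k (A.V ⊗[k] (B.V ⊗[k] C.V)) :=
  (Module.endTensorEndAlgHom (R := k) (S := k) (A := k)).comp
    (Algebra.TensorProduct.map A.ρ (actTwo B C))

theorem actThree_tmul (A B C : RepDouble β) (a b c : TwistedDouble β) :
    actThree A B C (a ⊗ₜ (b ⊗ₜ c)) =
      TensorProduct.map (A.ρ a) (TensorProduct.map (B.ρ b) (C.ρ c)) := rfl

/-- The tensor product of modules: `D^β(k[G])` acts through `Δ`. -/
noncomputable abbrev tensor (A B : RepDouble β) : RepDouble β where
  V := A.V ⊗[k] B.V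
  ρ := (actTwo A B).comp (comul β)

/-- The unit module: `k` with `D^β(k[G])` acting through `ε`. -/
noncomputable abbrev unit (β : NormalizedCocycle G k) : RepDouble β where
  V := k
  ρ := (Algebra.lmul k k).comp (counit β)

theorem tensor_ρ_elt {A B : RepDouble β} (a b x : G) (v : A.V) (w : B.V)
    (hv : A.Homog a v) (hw : B.Homog b w) (g : G) [DecidableEq G] :
    (tensor A B).ρ (elt β g x) (v ⊗ₜ[k] w) =
      if g = x * (a * b) * x⁻¹ then
        (β.γ x (x * a * x⁻¹) (x * b * x⁻¹) : k) • (A.φ x v ⊗ₜ[k] B.φ x w) else 0 := by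
  classical
  change actTwo A B (comul β (elt β g x)) (v ⊗ₜ[k] w) = _
  simp only [comul_elt, map_sum, map_smul, actTwo_tmul, LinearMap.sum_apply,
    LinearMap.smul_apply, TensorProduct.map_tmul, ρ_homog hv, ρ_homog hw]
  have e : (x * a * x⁻¹)⁻¹ * g = x * b * x⁻¹ ↔ g = x * (a * b) * x⁻¹ := by
    rw [inv_mul_eq_iff_eq_mul]; simp [mul_assoc]
  rw [Finset.sum_eq_single (x * a * x⁻¹)]
  · by_cases h : g = x * (a * b) * x⁻¹
    · rw [if_pos rfl, if_pos (e.2 h), if_pos h, e.2 h]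
    · rw [if_neg (fun h' => h (e.1 h')), if_neg h]; simp
  · intro c _ hc
    simp [if_neg hc]
  · simp

theorem Homog.tensor {A B : RepDouble β} {a b : G} {v : A.V} {w : B.V}
    (hv : A.Homog a v) (hw : B.Homog b w) : (tensor A B).Homog (a * b) (v ⊗ₜ[k] w) := by
  classical
  have := tensor_ρ_elt a b 1 v w hv hw (a * b)
  refine this.trans ?_
  simp [φ_one]

theorem tensor_φ {A B : RepDouble β} {a b x : G} {v : A.V} {w : B.V}
    (hv : A.Homog a v) (hw : B.Homog b w) :
    (RepDouble.tensor A B).φ x (v ⊗ₜ[k] w) =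
        (β.γ x (x * a * x⁻¹) (x * b * x⁻¹) : k) • (A.φ x v ⊗ₜ[k] B.φ x w) := by
  classical
  have := tensor_ρ_elt a b x v w hv hw (x * (a * b) * x⁻¹)
  rw [if_pos rfl] at this
  rw [← this, ρ_homog (hv.tensor hw), if_pos rfl]

theorem homog_unit (a : k) : (unit β).Homog 1 (show k from a) := by
  change counit β (elt β 1 1) * a = a
  rw [show counit β (elt β 1 1) = 1 by
    exact (counitLin_elt β 1 1).trans (if_pos rfl), one_mul]

theorem unit_φ (a : k) (x : G) : (unit β).φ x (show k from a) = a := by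
  classical
  have := ρ_homog (homog_unit (β := β) a) 1 x
  rw [if_pos (by simp)] at this
  rw [← this]
  change counit β (elt β 1 x) * a = a
  rw [show counit β (elt β 1 x) = 1 by
    exact (counitLin_elt β 1 x).trans (if_pos rfl), one_mul]

/-- Commutation with `φ` on a homogeneous vector gives commutation with the basis elements. -/
theorem comm_of_homog {A B : RepDouble β} (f : A.V →ₗ[k] B.V) {g : G} {v : A.V}
    (hv : A.Homog g v) (hfv : B.Homog g (f v)) (h : ∀ x, f (A.φ x v) = B.φ x (f v)) (a x : G) :
    f (A.ρ (elt β a x) v) = B.ρ (elt β a x) (f v) := by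
  classical
  rw [ρ_homog hv, ρ_homog hfv]
  split_ifs
  · exact h x
  · simp

/-- The associativity constraint `(u ⊗ v) ⊗ w ↦ Φ (u ⊗ (v ⊗ w))`. -/
noncomputable def assocLin (A B C : RepDouble β) :
    (A.V ⊗[k] B.V) ⊗[k] C.V →ₗ[k] A.V ⊗[k] (B.V ⊗[k] C.V) :=
  actThree A B C (Φ β) ∘ₗ (TensorProduct.assoc k A.V B.V C.V).toLinearMap

theorem actThree_diag {A B C : RepDouble β} (c : G → G → G → kˣ) {g h l : G}
    {u : A.V} {v : B.V} {w : C.V} (hu : A.Homog g u) (hv : B.Homog h v) (hw : C.Homog l w) :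
    actThree A B C (∑ g : G, ∑ h : G, ∑ l : G,
      (c g h l).val • (elt β g 1 ⊗ₜ[k] (elt β h 1 ⊗ₜ[k] elt β l 1))) (u ⊗ₜ[k] (v ⊗ₜ[k] w)) =
      (c g h l : k) • (u ⊗ₜ[k] (v ⊗ₜ[k] w)) := by
  classical
  simp only [map_sum, map_smul, actThree_tmul, LinearMap.sum_apply,
    LinearMap.smul_apply, TensorProduct.map_tmul, homog_proj_eq hu, homog_proj_eq hv,
    homog_proj_eq hw]
  rw [Finset.sum_eq_single g, Finset.sum_eq_single h, Finset.sum_eq_single l] <;>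
    simp +contextual

theorem assocLin_homog {A B C : RepDouble β} {g h l : G}
    {u : A.V} {v : B.V} {w : C.V} (hu : A.Homog g u) (hv : B.Homog h v) (hw : C.Homog l w) :
    assocLin A B C ((u ⊗ₜ[k] v) ⊗ₜ[k] w) =
      ((β.toFun g h l)⁻¹ : kˣ).val • (u ⊗ₜ[k] (v ⊗ₜ[k] w)) :=
  actThree_diag (fun g h l => (β.toFun g h l)⁻¹) hu hv hw

/-- The inverse of the associativity constraint. -/
noncomputable def assocInvLin (A B C : RepDouble β) :
    A.V ⊗[k] (B.V ⊗[k] C.V) →ₗ[k] (A.V ⊗[k] B.V) ⊗[k] C.V :=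
  (TensorProduct.assoc k A.V B.V C.V).symm.toLinearMap ∘ₗ
    actThree A B C (∑ g : G, ∑ h : G, ∑ l : G,
      (β.toFun g h l).val • (elt β g 1 ⊗ₜ[k] (elt β h 1 ⊗ₜ[k] elt β l 1)))

theorem assocInvLin_homog {A B C : RepDouble β} {g h l : G}
    {u : A.V} {v : B.V} {w : C.V} (hu : A.Homog g u) (hv : B.Homog h v) (hw : C.Homog l w) :
    assocInvLin A B C (u ⊗ₜ[k] (v ⊗ₜ[k] w)) =
      (β.toFun g h l : k) • ((u ⊗ₜ[k] v) ⊗ₜ[k] w) := by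
  have := actThree_diag β.toFun hu hv hw
  rw [assocInvLin, LinearMap.comp_apply, this]
  simp

/-- The associativity constraint as a homomorphism of modules. -/
noncomputable def assocHom (A B C : RepDouble β) :
    tensor (tensor A B) C ⟶ tensor A (tensor B C) :=
  mkHom (A := tensor (tensor A B) C) (B := tensor A (tensor B C)) (assocLin A B C) (by
    intro a x v
    refine LinearMap.congr_fun (f := assocLin A B C ∘ₗ (tensor (tensor A B) C).ρ (elt β a x))
      (g := (tensor A (tensor B C)).ρ (elt β a x) ∘ₗ assocLin A B C) ?_ v
    refine lin_ext₃ fun g u h v l w hu hv hw => ?_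
    refine comm_of_homog (A := tensor (tensor A B) C) (B := tensor A (tensor B C))
      (assocLin A B C) ((hu.tensor hv).tensor hw) ?_ ?_ a x
    · rw [assocLin_homog hu hv hw, mul_assoc, Homog, map_smul]
      exact congrArg _ (hu.tensor (hv.tensor hw))
    · intro x
      rw [assocLin_homog hu hv hw, map_smul, tensor_φ (hu.tensor hv) hw, tensor_φ hu hv,
        tensor_φ hu (hv.tensor hw), tensor_φ hv hw]
      simp only [← TensorProduct.smul_tmul', TensorProduct.tmul_smul, map_smul]
      have hA := assocLin_homog (homog_φ hu x) (homog_φ hv x) (homog_φ hw x)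
      rw [hA]
      simp only [smul_smul]
      congr 1
      have := congrArg Units.val (β.γ_assoc x (x * g * x⁻¹) (x * h * x⁻¹) (x * l * x⁻¹))
      simp only [mul_assoc, inv_mul_cancel_left, inv_mul_cancel, mul_one, Units.val_mul] at this ⊢
      linear_combination this)

/-- A homomorphism with a linear inverse is an isomorphism. -/
def mkIso {A B : RepDouble β} (f : A ⟶ B) (g : B.V →ₗ[k] A.V) (h1 : g ∘ₗ f.lin = LinearMap.id)
    (h2 : f.lin ∘ₗ g = LinearMap.id) : A ≅ B where
  hom := f
  inv := ⟨g, fun a v => by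
    have e1 : ∀ v, g (f.lin v) = v := LinearMap.congr_fun h1
    have e2 : ∀ v, f.lin (g v) = v := LinearMap.congr_fun h2
    have := congrArg g (f.comm a (g v))
    rw [e1, e2] at this
    exact this.symm⟩
  hom_inv_id := hom_ext h1
  inv_hom_id := hom_ext h2

/-- The associativity constraint. -/
noncomputable def assoc (A B C : RepDouble β) :
    tensor (tensor A B) C ≅ tensor A (tensor B C) :=
  mkIso (assocHom A B C) (assocInvLin A B C)
    (by
      refine lin_ext₃ fun g u h v l w hu hv hw => ?_
      change assocInvLin A B C (assocLin A B C _) = _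
      rw [assocLin_homog hu hv hw, map_smul, assocInvLin_homog hu hv hw, smul_smul]
      simp)
    (by
      refine lin_ext₃' fun g u h v l w hu hv hw => ?_
      change assocLin A B C (assocInvLin A B C _) = _
      rw [assocInvLin_homog hu hv hw, map_smul, assocLin_homog hu hv hw, smul_smul]
      simp)

/-- The left unit constraint `c ⊗ v ↦ c v`. -/
noncomputable def leftUnit (A : RepDouble β) : tensor (unit β) A ≅ A :=
  mkIso (mkHom (A := tensor (unit β) A) (TensorProduct.lid k A.V).toLinearMap (by
    intro a x v
    refine LinearMap.congr_fun
      (f := (TensorProduct.lid k A.V).toLinearMap ∘ₗ (tensor (unit β) A).ρ (elt β a x))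
      (g := A.ρ (elt β a x) ∘ₗ (TensorProduct.lid k A.V).toLinearMap) ?_ v
    apply TensorProduct.ext
    ext1
    refine lin_ext fun g v hv => ?_
    have h1 := homog_unit (β := β) 1
    refine comm_of_homog (A := tensor (unit β) A) (B := A) (TensorProduct.lid k A.V).toLinearMap
      (h1.tensor hv) ?_ ?_ a x
    · simpa using hv
    · intro x
      rw [tensor_φ h1 hv, unit_φ]
      simp)) (TensorProduct.lid k A.V).symm.toLinearMap
    (by ext : 1; simp [mkHom]) (by ext : 1; simp [mkHom])

/-- The right unit constraint `v ⊗ c ↦ c v`. -/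
noncomputable def rightUnit (A : RepDouble β) : tensor A (unit β) ≅ A :=
  mkIso (mkHom (A := tensor A (unit β)) (TensorProduct.rid k A.V).toLinearMap (by
    intro a x v
    refine LinearMap.congr_fun
      (f := (TensorProduct.rid k A.V).toLinearMap ∘ₗ (tensor A (unit β)).ρ (elt β a x))
      (g := A.ρ (elt β a x) ∘ₗ (TensorProduct.rid k A.V).toLinearMap) ?_ v
    apply TensorProduct.ext
    refine lin_ext fun g v hv => ?_
    ext1
    have h1 := homog_unit (β := β) 1
    refine comm_of_homog (A := tensor A (unit β)) (B := A) (TensorProduct.rid k A.V).toLinearMap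
      (hv.tensor h1) ?_ ?_ a x
    · simpa using hv
    · intro x
      rw [tensor_φ hv h1, unit_φ]
      simp)) (TensorProduct.rid k A.V).symm.toLinearMap
    (by ext : 1; simp [mkHom]) (by ext : 1; simp [mkHom])

theorem actTwo_naturality {A A' B B' : RepDouble β} (f : A ⟶ A') (g : B ⟶ B')
    (t : TwistedDouble β ⊗[k] TwistedDouble β) (v : A.V ⊗[k] B.V) :
    TensorProduct.map f.lin g.lin (actTwo A B t v) =
      actTwo A' B' t (TensorProduct.map f.lin g.lin v) := by
  induction t using TensorProduct.induction_on with
  | zero => simp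
  | add t t' h h' => simp [h, h']
  | tmul a b =>
    refine LinearMap.congr_fun (f := TensorProduct.map f.lin g.lin ∘ₗ actTwo A B (a ⊗ₜ b))
      (g := actTwo A' B' (a ⊗ₜ b) ∘ₗ TensorProduct.map f.lin g.lin) ?_ v
    ext v w
    simp [actTwo_tmul, f.comm, g.comm]

/-- The tensor product of homomorphisms. -/
noncomputable def tensorHom {A A' B B' : RepDouble β} (f : A ⟶ A') (g : B ⟶ B') :
    tensor A B ⟶ tensor A' B' where
  lin := TensorProduct.map f.lin g.lin
  comm a v := actTwo_naturality f g (comul β a) v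

noncomputable instance : MonoidalCategoryStruct (RepDouble β) where
  tensorObj := tensor
  tensorUnit := unit β
  tensorHom := tensorHom
  whiskerLeft A _ _ g := tensorHom (𝟙 A) g
  whiskerRight f B := tensorHom f (𝟙 B)
  associator := assoc
  leftUnitor := leftUnit
  rightUnitor := rightUnit

/-- The modules over `D^β(k[G])` form a monoidal category. -/
noncomputable instance : MonoidalCategory (RepDouble β) :=
  MonoidalCategory.ofTensorHom
    (id_tensorHom_id := fun A B => hom_ext TensorProduct.map_id)
    (tensorHom_comp_tensorHom := fun f₁ f₂ g₁ g₂ => hom_ext (by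
      exact (TensorProduct.map_comp _ _ _ _).symm))
    (associator_naturality := fun {A B C A' B' C'} f g h => hom_ext (by
      refine lin_ext₃ fun a u b v c w hu hv hw => ?_
      change assocLin A' B' C' ((f.lin u ⊗ₜ g.lin v) ⊗ₜ h.lin w) =
        TensorProduct.map f.lin (TensorProduct.map g.lin h.lin) (assocLin A B C _)
      rw [assocLin_homog hu hv hw, assocLin_homog (hu.map f) (hv.map g) (hw.map h)]
      simp))
    (leftUnitor_naturality := fun {A B} f => hom_ext (by
      apply TensorProduct.ext'
      intro c v
      exact (f.lin.map_smul c v).symm))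
    (rightUnitor_naturality := fun {A B} f => hom_ext (by
      apply TensorProduct.ext'
      intro v c
      exact (f.lin.map_smul c v).symm))
    (pentagon := fun A B C D => hom_ext (by
      refine lin_ext₄ fun a u b v c w d x hu hv hw hx => ?_
      change TensorProduct.map LinearMap.id (assocLin B C D) (assocLin A (tensor B C) D
        (TensorProduct.map (assocLin A B C) LinearMap.id (((u ⊗ₜ v) ⊗ₜ w) ⊗ₜ x))) =
        assocLin A B (tensor C D) (assocLin (tensor A B) C D (((u ⊗ₜ v) ⊗ₜ w) ⊗ₜ x))
      rw [TensorProduct.map_tmul, assocLin_homog hu hv hw, ← TensorProduct.smul_tmul', map_smul,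
        LinearMap.id_apply, assocLin_homog hu (hv.tensor hw) hx, map_smul, map_smul,
        TensorProduct.map_tmul, assocLin_homog hv hw hx, assocLin_homog (hu.tensor hv) hw hx,
        map_smul, assocLin_homog hu hv (hw.tensor hx), TensorProduct.tmul_smul, smul_smul,
        smul_smul, smul_smul]
      have := congrArg (fun t => (t⁻¹ : kˣ).val) (β.cocycle a b c d)
      simp only [mul_inv, Units.val_mul] at this
      congr 1
      linear_combination this))
    (triangle := fun A B => hom_ext (by
      apply TensorProduct.ext
      apply TensorProduct.ext
      refine lin_ext fun a u hu => ?_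
      ext1
      refine lin_ext fun b v hv => ?_
      have h1 := homog_unit (β := β) 1
      change TensorProduct.map LinearMap.id (TensorProduct.lid k B.V).toLinearMap
        (assocLin A (unit β) B ((u ⊗ₜ (1 : k)) ⊗ₜ v)) =
        TensorProduct.map (TensorProduct.rid k A.V).toLinearMap LinearMap.id ((u ⊗ₜ (1 : k)) ⊗ₜ v)
      rw [assocLin_homog hu h1 hv]
      simp [β.one_middle]))

/-- The braiding `u ⊗ v ↦ τ (R (u ⊗ v))`, where `τ` is the flip. -/
noncomputable def braidLin (A B : RepDouble β) : A.V ⊗[k] B.V →ₗ[k] B.V ⊗[k] A.V :=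
  (TensorProduct.comm k A.V B.V).toLinearMap ∘ₗ actTwo A B (R β)

theorem braidLin_homog {A B : RepDouble β} {g : G} {u : A.V} (hu : A.Homog g u) (v : B.V) :
    braidLin A B (u ⊗ₜ[k] v) = B.φ g v ⊗ₜ[k] u := by
  classical
  simp only [braidLin, R, map_sum, LinearMap.comp_apply, LinearMap.sum_apply, actTwo_tmul,
    TensorProduct.map_tmul, homog_proj_eq hu]
  rw [Finset.sum_eq_single g]
  · simp [φ]
  · simp +contextual
  · simp

/-- The braiding as a homomorphism of modules. -/
noncomputable def braidHom (A B : RepDouble β) : tensor A B ⟶ tensor B A :=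
  mkHom (A := tensor A B) (B := tensor B A) (braidLin A B) (by
    intro a x v
    refine LinearMap.congr_fun (f := braidLin A B ∘ₗ (tensor A B).ρ (elt β a x))
      (g := (tensor B A).ρ (elt β a x) ∘ₗ braidLin A B) ?_ v
    refine lin_ext₂ fun g u h v hu hv => ?_
    refine comm_of_homog (A := tensor A B) (B := tensor B A) (braidLin A B) (hu.tensor hv) ?_ ?_ a x
    · rw [braidLin_homog hu]
      have := (homog_φ hv g).tensor hu
      simpa using this
    · intro x
      rw [braidLin_homog hu, tensor_φ hu hv, tensor_φ (homog_φ hv g) hu, map_smul,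
        braidLin_homog (homog_φ hu x), φ_φ hv, φ_φ hv]
      have e : x * g * x⁻¹ * x = x * g := by simp
      have := congrArg Units.val (β.γ_braid x g h)
      simp only [Units.val_mul] at this
      rw [e, ← TensorProduct.smul_tmul', ← TensorProduct.smul_tmul', smul_smul, smul_smul, this])

/-- The inverse of the braiding. -/
noncomputable def braidInvLin (A B : RepDouble β) : B.V ⊗[k] A.V →ₗ[k] A.V ⊗[k] B.V :=
  actTwo A B (∑ g : G, elt β g 1 ⊗ₜ[k] (∑ h : G, ((β.θ h g⁻¹ g)⁻¹ : kˣ).val • elt β h g⁻¹)) ∘ₗ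
    (TensorProduct.comm k B.V A.V).toLinearMap

theorem braidInvLin_homog {A B : RepDouble β} {g m : G} {u : A.V} {w : B.V} (hu : A.Homog g u)
    (hw : B.Homog m w) : braidInvLin A B (w ⊗ₜ[k] u) =
      ((β.θ (g⁻¹ * m * g) g⁻¹ g)⁻¹ : kˣ).val • (u ⊗ₜ[k] B.φ g⁻¹ w) := by
  classical
  simp only [braidInvLin, map_sum, LinearMap.comp_apply, LinearMap.sum_apply, actTwo_tmul,
    TensorProduct.map_tmul, homog_proj_eq hu, LinearEquiv.coe_coe, TensorProduct.comm_tmul,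
    map_smul, LinearMap.smul_apply, ρ_homog hw]
  rw [Finset.sum_eq_single g]
  · rw [if_pos rfl, Finset.sum_eq_single (g⁻¹ * m * g)]
    · simp
    · intro h _ hh
      rw [if_neg (by simpa using hh), smul_zero]
    · simp
  · simp +contextual
  · simp

/-- The braiding. -/
noncomputable def braid (A B : RepDouble β) : tensor A B ≅ tensor B A :=
  mkIso (braidHom A B) (braidInvLin A B)
    (by
      refine lin_ext₂ fun g u h v hu hv => ?_
      change braidInvLin A B (braidLin A B _) = _
      rw [braidLin_homog hu, braidInvLin_homog hu (homog_φ hv g), φ_φ hv, inv_mul_cancel, φ_one]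
      simp [mul_assoc])
    (by
      refine lin_ext₂ fun h v g u hv hu => ?_
      change braidLin A B (braidInvLin A B _) = _
      rw [braidInvLin_homog hu hv, map_smul, braidLin_homog hu, φ_φ hv, mul_inv_cancel, φ_one]
      have : β.θ (g⁻¹ * h * g) g⁻¹ g = β.θ h g g⁻¹ := by
        have := β.θ_cocycle h g g⁻¹ g
        simpa using this.symm
      rw [this]
      simp [← TensorProduct.smul_tmul', smul_smul])

theorem braid_naturality {A A' B B' : RepDouble β} (f : A ⟶ A') (g : B ⟶ B') :
    tensorHom f g ≫ (braid A' B').hom = (braid A B).hom ≫ tensorHom g f := hom_ext (by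
  refine lin_ext₂ fun a u b v hu hv => ?_
  change braidLin A' B' (f.lin u ⊗ₜ g.lin v) = TensorProduct.map g.lin f.lin (braidLin A B _)
  rw [braidLin_homog hu, braidLin_homog (hu.map f), TensorProduct.map_tmul, hom_φ])

/-- The modules over `D^β(k[G])` form a braided monoidal category. -/
noncomputable instance : BraidedCategory (RepDouble β) where
  braiding := braid
  braiding_naturality_right A _ _ f := braid_naturality (𝟙 A) f
  braiding_naturality_left f B := braid_naturality f (𝟙 B)
  hexagon_forward A B C := hom_ext (by
    refine lin_ext₃ fun a u b v c w hu hv hw => ?_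
    change assocLin B C A (braidLin A (tensor B C) (assocLin A B C ((u ⊗ₜ v) ⊗ₜ w))) =
      TensorProduct.map LinearMap.id (braidLin A C) (assocLin B A C
        (TensorProduct.map (braidLin A B) LinearMap.id ((u ⊗ₜ v) ⊗ₜ w)))
    rw [assocLin_homog hu hv hw, map_smul, braidLin_homog hu, tensor_φ hv hw,
      ← TensorProduct.smul_tmul', map_smul, map_smul,
      assocLin_homog (homog_φ hv a) (homog_φ hw a) hu, TensorProduct.map_tmul, braidLin_homog hu,
      LinearMap.id_apply, assocLin_homog (homog_φ hv a) hu hw, map_smul, TensorProduct.map_tmul,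
      braidLin_homog hu, LinearMap.id_apply, smul_smul, smul_smul, ← Units.val_mul,
      ← Units.val_mul]
    have := β.θ_hexagon a b c
    congr 2
    rw [eq_comm, inv_eq_iff_mul_eq_one]
    rw [← eq_mul_inv_iff_mul_eq] at this
    rw [this]
    apply Additive.ofMul.injective
    simp only [ofMul_mul, ofMul_inv, ofMul_one]
    abel)
  hexagon_reverse A B C := hom_ext (by
    refine lin_ext₃' fun a u b v c w hu hv hw => ?_
    change assocInvLin C A B (braidLin (tensor A B) C (assocInvLin A B C (u ⊗ₜ (v ⊗ₜ w)))) =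
      TensorProduct.map (braidLin A C) LinearMap.id (assocInvLin A C B
        (TensorProduct.map LinearMap.id (braidLin B C) (u ⊗ₜ (v ⊗ₜ w))))
    rw [assocInvLin_homog hu hv hw, map_smul, braidLin_homog (hu.tensor hv), map_smul,
      assocInvLin_homog (homog_φ hw (a * b)) hu hv, TensorProduct.map_tmul, braidLin_homog hv,
      LinearMap.id_apply, assocInvLin_homog hu (homog_φ hw b) hv, map_smul, TensorProduct.map_tmul,
      braidLin_homog hu, LinearMap.id_apply, φ_φ hw, ← TensorProduct.smul_tmul',
      ← TensorProduct.smul_tmul', smul_smul, smul_smul, ← Units.val_mul,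
      ← Units.val_mul]
    have := β.θ_hexagon' a b c
    congr 2
    rw [mul_comm, ← this, mul_comm])

end RepDouble

/-- A finite-dimensional `α`-twisted representation of the subgroup `H`: a map `ρ : H → GL(V)` with
`ρ(x) ρ(y) = α(x,y) ρ(xy)`. -/
structure TwistedRep (H : Subgroup G) (α : G → G → kˣ) where
  V : Type u
  [addCommGroup : AddCommGroup V]
  [module : Module k V]
  [finiteDimensional : FiniteDimensional k V]
  ρ : H → Module.End k V
  isUnit_ρ : ∀ x, IsUnit (ρ x)
  ρ_mul : ∀ x y, ρ x * ρ y = (α x y : k) • ρ (x * y)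

/-- `0 → U → V → W → 0` is exact. -/
def ShortExactLin {U V W : Type u} [AddCommGroup U] [AddCommGroup V] [AddCommGroup W]
    [Module k U] [Module k V] [Module k W] (f : U →ₗ[k] V) (g : V →ₗ[k] W) : Prop :=
  Function.Injective f ∧ Function.Exact f g ∧ Function.Surjective g

namespace TwistedRep
attribute [instance] addCommGroup module finiteDimensional
variable {H K : Subgroup G} {α : G → G → kˣ}

/-- An intertwiner of twisted representations. -/
@[ext]
structure Hom (A B : TwistedRep H α) where
  lin : A.V →ₗ[k] B.V
  comm : ∀ x v, lin (A.ρ x v) = B.ρ x (lin v)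

instance : Category (TwistedRep H α) where
  Hom := Hom
  id A := ⟨LinearMap.id, fun _ _ => rfl⟩
  comp f g := ⟨g.lin ∘ₗ f.lin, fun a v => by simp [f.comm, g.comm]⟩

@[ext]

theorem hom_ext {A B : TwistedRep H α} {f g : A ⟶ B} (h : f.lin = g.lin) : f = g := Hom.ext h

@[simp] theorem id_lin (A : TwistedRep H α) : Hom.lin (𝟙 A) = LinearMap.id := rfl

@[simp] theorem comp_lin {A B C : TwistedRep H α} (f : A ⟶ B) (g : B ⟶ C) :
    (f ≫ g).lin = g.lin ∘ₗ f.lin := rfl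

theorem isUnit_of_one {V : Type u} [AddCommGroup V] [Module k V] (ρ : H → Module.End k V)
    (h1 : ρ 1 = 1) (hm : ∀ x y, ρ x * ρ y = (α x y : k) • ρ (x * y)) (x : H) : IsUnit (ρ x) := by
  rw [isUnit_iff_exists_and_exists]
  refine ⟨⟨((α x (x⁻¹ : H) : kˣ)⁻¹ : kˣ).val • ρ x⁻¹, ?_⟩,
    ⟨((α (x⁻¹ : H) x : kˣ)⁻¹ : kˣ).val • ρ x⁻¹, ?_⟩⟩
  · rw [mul_smul_comm, hm, smul_smul, mul_inv_cancel, h1, Units.inv_mul, one_smul]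
  · rw [smul_mul_assoc, hm, smul_smul, inv_mul_cancel, h1, Units.inv_mul, one_smul]

/-- Restriction to a subgroup. -/
def res (hHK : H ≤ K) (A : TwistedRep K α) : TwistedRep H α where
  V := A.V
  ρ x := A.ρ (Subgroup.inclusion hHK x)
  isUnit_ρ x := A.isUnit_ρ _
  ρ_mul x y := A.ρ_mul _ _

def resMap (hHK : H ≤ K) {A B : TwistedRep K α} (f : A ⟶ B) : res hHK A ⟶ res hHK B where
  lin := f.lin
  comm x v := f.comm _ v

/-- The trivial one-dimensional representation. -/
def trivial (h : ∀ x y : H, α x y = 1) : TwistedRep H α where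
  V := k
  ρ _ := 1
  isUnit_ρ _ := isUnit_one
  ρ_mul x y := by simp [h]

/-- The zero representation. -/
def zero : TwistedRep H α where
  V := PUnit
  ρ _ := 1
  isUnit_ρ _ := isUnit_one
  ρ_mul x y := Subsingleton.elim _ _

/-- The direct sum of finitely many twisted representations. -/
def pi {ι : Type u} [Finite ι] (A : ι → TwistedRep H α) : TwistedRep H α where
  V := ∀ i, (A i).V
  ρ x := LinearMap.pi fun i => (A i).ρ x ∘ₗ LinearMap.proj i
  isUnit_ρ x := by
    rw [Module.End.isUnit_iff]
    have h i := (Module.End.isUnit_iff _).1 ((A i).isUnit_ρ x)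
    constructor
    · intro v w e
      funext i
      exact (h i).1 (congrFun e i)
    · intro w
      choose v hv using fun i => (h i).2 (w i)
      exact ⟨v, funext hv⟩
  ρ_mul x y := by
    ext v i
    exact LinearMap.congr_fun ((A i).ρ_mul x y) (v i)

def piMap {ι : Type u} [Finite ι] {A B : ι → TwistedRep H α} (f : ∀ i, A i ⟶ B i) :
    pi A ⟶ pi B where
  lin := LinearMap.pi fun i => (f i).lin ∘ₗ LinearMap.proj i
  comm x v := funext fun i => (f i).comm x (v i)

/-- `α` is a (right normalized) 2-cocycle on the subgroup `K`. -/
structure IsCocycleOn (K : Subgroup G) (α : G → G → kˣ) : Prop where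
  cocycle : ∀ x y z : K, α x y * α (x * y) z = α x (y * z) * α y z
  one_right : ∀ x : K, α x 1 = 1

/-- The functions `f : K → V` with `ρ(h) f(x) = α(h,x) f(hx)` for `h ∈ H`, `x ∈ K`. -/
def indSubmodule (hHK : H ≤ K) (A : TwistedRep H α) : Submodule k (K → A.V) where
  carrier := {f | ∀ (h : H) (x : K), A.ρ h (f x) = (α h x : k) • f (Subgroup.inclusion hHK h * x)}
  add_mem' hf hg h x := by simp [hf h x, hg h x]
  zero_mem' h x := by simp
  smul_mem' c f hf h x := by simp [hf h x, smul_comm c]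

theorem indAux (hHK : H ≤ K) (hα : IsCocycleOn K α) (A : TwistedRep H α) (y : K) (f : K → A.V)
    (hf : f ∈ indSubmodule hHK A) :
    (fun x : K => (α x y : k) • f (x * y)) ∈ indSubmodule hHK A := by
  intro h x
  have := congrArg Units.val (hα.cocycle (Subgroup.inclusion hHK h) x y)
  simp only [Units.val_mul, Subgroup.coe_inclusion] at this
  simp only [map_smul, hf h (x * y), smul_smul, mul_assoc, Subgroup.coe_mul,
    Subgroup.coe_inclusion]
  rw [this, mul_comm]

/-- The action `(y f)(x) = α(x,y) f(xy)` of `K`. -/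
def indAct (hHK : H ≤ K) (hα : IsCocycleOn K α) (A : TwistedRep H α) (y : K) :
    Module.End k (indSubmodule hHK A) where
  toFun f := ⟨fun x => (α x y : k) • f.1 (x * y), indAux hHK hα A y f.1 f.2⟩
  map_add' f g := by ext x; simp
  map_smul' c f := by ext x; simp [smul_comm c]

theorem indAct_mul (hHK : H ≤ K) (hα : IsCocycleOn K α) (A : TwistedRep H α) (y z : K) :
    indAct hHK hα A y * indAct hHK hα A z = (α y z : k) • indAct hHK hα A (y * z) := by
  ext f x
  have := congrArg Units.val (hα.cocycle x y z)
  simp only [Units.val_mul] at this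
  change (α x y : k) • (α (x * y : K) z : k) • f.1 (x * y * z) =
    (α y z : k) • (α x (y * z : K) : k) • f.1 (x * (y * z))
  rw [smul_smul, smul_smul, mul_assoc, Subgroup.coe_mul, Subgroup.coe_mul, this, mul_comm]

/-- The `α`-twisted representation of `K` induced from `H`, realized on equivariant functions
(for finite groups this is the tensor product with the twisted group algebra of `K`). -/
def ind (hHK : H ≤ K) (hα : IsCocycleOn K α) [Finite K] (A : TwistedRep H α) :
    TwistedRep K α where
  V := indSubmodule hHK A
  ρ := indAct hHK hα A
  isUnit_ρ := isUnit_of_one _ (by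
    ext f x
    have := hα.one_right x
    simp [indAct, this]) (indAct_mul hHK hα A)
  ρ_mul := indAct_mul hHK hα A

def indMap (hHK : H ≤ K) (hα : IsCocycleOn K α) [Finite K] {A B : TwistedRep H α} (f : A ⟶ B) :
    ind hHK hα A ⟶ ind hHK hα B where
  lin :=
    { toFun := fun s => ⟨fun x => f.lin (s.1 x), fun h x => by
        rw [← f.comm, s.2 h x, map_smul]⟩
      map_add' := fun s t => Subtype.ext (funext fun x => f.lin.map_add _ _)
      map_smul' := fun c s => Subtype.ext (funext fun x => f.lin.map_smul _ _) }
  comm y s := Subtype.ext (funext fun x => f.lin.map_smul _ _)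

theorem indMap_exact (hHK : H ≤ K) (hα : IsCocycleOn K α) [Finite K] {A B C : TwistedRep H α}
    (f : A ⟶ B) (g : B ⟶ C) (h : ShortExactLin f.lin g.lin) :
    ShortExactLin (indMap hHK hα f).lin (indMap hHK hα g).lin := by
  obtain ⟨hi, he, hs⟩ := h
  refine ⟨fun s t e => Subtype.ext (funext fun x => hi (congrFun (congrArg Subtype.val e) x)),
    fun s => ⟨fun e => ?_, ?_⟩, fun s => ?_⟩
  · have h1 : ∀ x, ∃ v, f.lin v = s.1 x := fun x =>
      (he _).1 (congrFun (congrArg Subtype.val e) x)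
    choose t ht using h1
    refine ⟨⟨t, fun h x => hi ?_⟩, Subtype.ext (funext ht)⟩
    rw [f.comm, ht, s.2 h x, map_smul, ht]
  · rintro ⟨t, rfl⟩
    exact Subtype.ext (funext fun x => (he _).2 ⟨_, rfl⟩)
  · let r : K → K := fun x => (Quotient.out (s := QuotientGroup.rightRel (H.subgroupOf K))
      (Quotient.mk _ x))
    have hr : ∀ x, ∃ h : H, x = Subgroup.inclusion hHK h * r x := by
      intro x
      have h1 : (QuotientGroup.rightRel (H.subgroupOf K)).r (r x) x := Quotient.mk_out x
      rw [QuotientGroup.rightRel_apply] at h1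
      exact ⟨⟨_, h1⟩, by ext; simp⟩
    have hr' : ∀ (h : H) x, r (Subgroup.inclusion hHK h * x) = r x := by
      intro h x
      have : (Quotient.mk (QuotientGroup.rightRel (H.subgroupOf K)) (Subgroup.inclusion hHK h * x))
          = Quotient.mk _ x := by
        apply Quotient.sound
        change (QuotientGroup.rightRel (H.subgroupOf K)).r _ _
        rw [QuotientGroup.rightRel_apply]
        simp [Subgroup.mem_subgroupOf]
      simp only [r, this]
    choose η hη using hr
    have hη' : ∀ (h : H) x, η (Subgroup.inclusion hHK h * x) = h * η x := by
      intro h x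
      have h1 := hη (Subgroup.inclusion hHK h * x)
      rw [hr'] at h1
      conv_lhs at h1 => rw [hη x]
      rw [← mul_assoc, mul_left_inj, ← map_mul] at h1
      exact (Subgroup.inclusion_injective hHK h1).symm
    choose σ hσ using hs
    refine ⟨⟨fun x => ((α (η x) (r x))⁻¹ : kˣ).val • B.ρ (η x) (σ (s.1 (r x))), ?_⟩, ?_⟩
    · intro h x
      have hc := hα.cocycle (Subgroup.inclusion hHK h) (Subgroup.inclusion hHK (η x)) (r x)
      simp only [hη', hr']
      have hm := LinearMap.congr_fun (B.ρ_mul h (η x)) (σ (s.1 (r x)))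
      change B.ρ h (B.ρ (η x) _) = (α h (η x) : k) • B.ρ (h * η x) _ at hm
      rw [map_smul, hm, smul_smul, smul_smul, ← Units.val_mul, ← Units.val_mul]
      congr 2
      have hx : (x : G) = η x * r x := congrArg Subtype.val (hη x)
      simp only [Subgroup.coe_inclusion, Subgroup.coe_mul] at hc
      rw [← hx] at hc
      have hc' := congrArg Additive.ofMul hc
      apply Additive.ofMul.injective
      simp only [ofMul_mul, ofMul_inv, Subgroup.coe_mul, Subgroup.coe_inclusion] at hc' ⊢
      linear_combination (norm := abel) hc'
    · refine Subtype.ext (funext fun x => ?_)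
      change g.lin (((α (η x) (r x))⁻¹ : kˣ).val • B.ρ (η x) (σ (s.1 (r x)))) = s.1 x
      rw [map_smul, g.comm, hσ, s.2, ← hη x, smul_smul]
      simp

theorem piMap_exact {ι : Type u} [Finite ι] {A B C : ι → TwistedRep H α} (f : ∀ i, A i ⟶ B i)
    (g : ∀ i, B i ⟶ C i) (h : ∀ i, ShortExactLin (f i).lin (g i).lin) :
    ShortExactLin (piMap f).lin (piMap g).lin := by
  refine ⟨fun s t e => funext fun i => (h i).1 (congrFun e i), fun s => ⟨fun e => ?_, ?_⟩,
    fun s => ?_⟩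
  · choose t ht using fun i => ((h i).2.1 (s i)).1 (congrFun e i)
    exact ⟨t, funext ht⟩
  · rintro ⟨t, rfl⟩
    exact funext fun i => ((h i).2.1 _).2 ⟨_, rfl⟩
  · choose t ht using fun i => (h i).2.2 (s i)
    exact ⟨t, funext ht⟩

end TwistedRep

theorem ShortExactLin.map_id {U V W X : Type u} [AddCommGroup U] [AddCommGroup V] [AddCommGroup W]
    [AddCommGroup X] [Module k U] [Module k V] [Module k W] [Module k X] {f : U →ₗ[k] V}
    {g : V →ₗ[k] W} (h : ShortExactLin f g) :
    ShortExactLin (TensorProduct.map f (LinearMap.id : X →ₗ[k] X)) (TensorProduct.map g LinearMap.id) :=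
  ⟨Module.Flat.rTensor_preserves_injective_linearMap (M := X) f h.1,
    Module.Flat.rTensor_exact X h.2.1, LinearMap.rTensor_surjective X h.2.2⟩

theorem ShortExactLin.id_map {U V W X : Type u} [AddCommGroup U] [AddCommGroup V] [AddCommGroup W]
    [AddCommGroup X] [Module k U] [Module k V] [Module k W] [Module k X] {f : U →ₗ[k] V}
    {g : V →ₗ[k] W} (h : ShortExactLin f g) :
    ShortExactLin (TensorProduct.map (LinearMap.id : X →ₗ[k] X) f) (TensorProduct.map LinearMap.id g) :=
  ⟨Module.Flat.lTensor_preserves_injective_linearMap (M := X) f h.1,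
    Module.Flat.lTensor_exact X h.2.1, LinearMap.lTensor_surjective X h.2.2⟩

namespace NormalizedCocycle
variable (β : NormalizedCocycle G k)

theorem mem_conj {g x z m : G} (hm : m = x * g * x⁻¹)
    (hz : z ∈ Subgroup.centralizer {m}) : x⁻¹ * z * x ∈ Subgroup.centralizer {g} := by
  rw [Subgroup.mem_centralizer_singleton_iff] at hz ⊢
  subst hm
  have := congrArg (fun t => x⁻¹ * t * x) hz
  simpa [mul_assoc] using this

theorem conj_of_mem {g z : G} (hz : z ∈ Subgroup.centralizer {g}) : z⁻¹ * g * z = g := by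
  rw [Subgroup.mem_centralizer_singleton_iff] at hz
  rw [mul_assoc, ← hz, inv_mul_cancel_left]

theorem θ_isCocycleOn (g : G) : TwistedRep.IsCocycleOn (Subgroup.centralizer {g}) (β.θ g) where
  cocycle x y z := by
    have := β.θ_cocycle g x y z
    rwa [conj_of_mem x.2] at this
  one_right x := β.θ_one_right g x

theorem conj_scalar {g x z w m : G} (hm : m = x * g * x⁻¹)
    (hz : z ∈ Subgroup.centralizer {m}) (hw : w ∈ Subgroup.centralizer {m}) :
    (β.θ m z x / β.θ m x (x⁻¹ * z * x)) * (β.θ m w x / β.θ m x (x⁻¹ * w * x)) *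
      β.θ g (x⁻¹ * z * x) (x⁻¹ * w * x) =
    β.θ m z w * (β.θ m (z * w) x / β.θ m x (x⁻¹ * (z * w) * x)) := by
  have h1 := β.θ_cocycle m z w x
  have h2 := β.θ_cocycle m x (x⁻¹ * z * x) (x⁻¹ * w * x)
  have h3 := β.θ_cocycle m z x (x⁻¹ * w * x)
  rw [conj_of_mem hz] at h1 h3
  have hg : x⁻¹ * m * x = g := by subst hm; simp [mul_assoc]
  rw [hg] at h2
  have h1 := congrArg Additive.ofMul h1
  have h2 := congrArg Additive.ofMul h2
  have h3 := congrArg Additive.ofMul h3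
  apply Additive.ofMul.injective
  simp only [ofMul_mul, ofMul_div, mul_assoc, mul_inv_cancel_left] at h1 h2 h3 ⊢
  linear_combination (norm := abel) h3 - h1 - h2

end NormalizedCocycle

open NormalizedCocycle in
/-- Pullback along the isomorphism `z ↦ x⁻¹zx` of centralizers `Z(m) → Z(g)`, `m = xgx⁻¹`: this
is the canonical isomorphism of stacks between `[{m}/Z(m)]` and `[{g}/Z(g)]`, together with the
isomorphism of the twists `θ_g` and `θ_m` that `θ` provides. -/
noncomputable def TwistedRep.conj (β : NormalizedCocycle G k) {g m : G} (x : G)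
    (hm : m = x * g * x⁻¹) (A : TwistedRep (Subgroup.centralizer {g}) (β.θ g)) :
    TwistedRep (Subgroup.centralizer {m}) (β.θ m) where
  V := A.V
  ρ z := (β.θ m z x / β.θ m x (x⁻¹ * z * x) : kˣ).val • A.ρ ⟨x⁻¹ * z * x, mem_conj hm z.2⟩
  isUnit_ρ z := (A.isUnit_ρ _).smul (β.θ m z x / β.θ m x (x⁻¹ * z * x))
  ρ_mul z w := by
    rw [smul_mul_smul_comm, A.ρ_mul, smul_smul, smul_smul, ← Units.val_mul, ← Units.val_mul,
      ← Units.val_mul, β.conj_scalar hm z.2 w.2]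
    refine congrArg _ (congrArg A.ρ (Subtype.ext ?_))
    simp [mul_assoc]

noncomputable def TwistedRep.conjMap (β : NormalizedCocycle G k) {g m : G} (x : G)
    (hm : m = x * g * x⁻¹) {A B : TwistedRep (Subgroup.centralizer {g}) (β.θ g)} (f : A ⟶ B) :
    A.conj β x hm ⟶ B.conj β x hm where
  lin := f.lin
  comm z v := (f.lin.map_smul _ _).trans (congrArg _ (f.comm _ v))

theorem conj_of_mem_pair {a b z : G} (hz : z ∈ Subgroup.centralizer {a, b}) :
    z⁻¹ * a * z = a ∧ z⁻¹ * b * z = b := by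
  rw [Subgroup.mem_centralizer_iff] at hz
  constructor
  · rw [mul_assoc, hz a (by simp), inv_mul_cancel_left]
  · rw [mul_assoc, hz b (by simp), inv_mul_cancel_left]

/-- The twisted tensor product: for `x ∈ Z(a,b)` the action is `γ_x(a,b) ρ(x) ⊗ ρ'(x)`. -/
noncomputable def TwistedRep.tensor (β : NormalizedCocycle G k) {a b m : G} (hm : a * b = m)
    (A : TwistedRep (Subgroup.centralizer {a, b}) (β.θ a))
    (B : TwistedRep (Subgroup.centralizer {a, b}) (β.θ b)) :
    TwistedRep (Subgroup.centralizer {a, b}) (β.θ m) where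
  V := A.V ⊗[k] B.V
  ρ x := (β.γ x a b : k) • TensorProduct.map (A.ρ x) (B.ρ x)
  isUnit_ρ x := by
    refine IsUnit.smul (β.γ x a b) ?_
    rw [Module.End.isUnit_iff]
    exact TensorProduct.map_bijective ((Module.End.isUnit_iff _).1 (A.isUnit_ρ x))
      ((Module.End.isUnit_iff _).1 (B.isUnit_ρ x))
  ρ_mul x y := by
    subst hm
    obtain ⟨h1, h2⟩ := conj_of_mem_pair x.2
    have := β.γ_θ a b x y
    rw [h1, h2] at this
    have := congrArg Units.val this
    simp only [Units.val_mul] at this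
    rw [smul_mul_smul_comm, ← TensorProduct.map_mul, A.ρ_mul, B.ρ_mul, TensorProduct.map_smul_left,
      TensorProduct.map_smul_right, smul_smul, smul_smul, smul_smul, Subgroup.coe_mul, ← this,
      mul_assoc, mul_assoc]

noncomputable def TwistedRep.tensorMap (β : NormalizedCocycle G k) {a b m : G} (hm : a * b = m)
    {A A' : TwistedRep (Subgroup.centralizer {a, b}) (β.θ a)}
    {B B' : TwistedRep (Subgroup.centralizer {a, b}) (β.θ b)} (f : A ⟶ A') (g : B ⟶ B') :
    A.tensor β hm B ⟶ A'.tensor β hm B' where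
  lin := TensorProduct.map f.lin g.lin
  comm x v := by
    refine LinearMap.congr_fun (f := TensorProduct.map f.lin g.lin ∘ₗ (A.tensor β hm B).ρ x)
      (g := (A'.tensor β hm B').ρ x ∘ₗ TensorProduct.map f.lin g.lin) ?_ v
    apply TensorProduct.ext'
    intro v w
    change TensorProduct.map f.lin g.lin ((β.γ x a b : k) • (A.ρ x v ⊗ₜ[k] B.ρ x w)) =
      (β.γ x a b : k) • (A'.ρ x (f.lin v) ⊗ₜ[k] B'.ρ x (g.lin w))
    rw [map_smul, TensorProduct.map_tmul, f.comm, g.comm]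

/-- A chosen representative of a conjugacy class. -/
noncomputable def classRep (c : ConjClasses G) : G := Quotient.out (s := IsConj.setoid G) c

theorem mk_classRep (c : ConjClasses G) : ConjClasses.mk (classRep c) = c :=
  Quotient.out_eq (s := IsConj.setoid G) c

theorem exists_conjugator (m : G) : ∃ x, m = x * classRep (ConjClasses.mk m) * x⁻¹ := by
  have := ConjClasses.mk_eq_mk_iff_isConj.1 (mk_classRep (ConjClasses.mk m))
  obtain ⟨x, hx⟩ := isConj_iff.1 this
  exact ⟨x, hx.symm⟩

/-- A chosen element that conjugates the representative of the class of `m` to `m`. -/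
noncomputable def conjugator (m : G) : G := Classical.choose (exists_conjugator m)

theorem conjugator_spec (m : G) : m = conjugator m * classRep (ConjClasses.mk m) * (conjugator m)⁻¹ :=
  Classical.choose_spec (exists_conjugator m)

/-- A `β`-twisted vector bundle on the inertia stack `I[pt/G] = ∐_{[g]} [pt/Z(g)]` of `[pt/G]`: for
each conjugacy class `[g]` a finite-dimensional `θ_g`-twisted representation of `Z(g)`. -/
abbrev InertiaBundle (β : NormalizedCocycle G k) : Type (u + 1) :=
  ∀ c : ConjClasses G, TwistedRep (Subgroup.centralizer {classRep c}) (β.θ (classRep c))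

/-- Simultaneous conjugacy of pairs `(m₁, m₂)` with `m₁m₂ = h`. An element that conjugates one such
pair to another centralizes `h`. -/
def pairSetoid (h : G) : Setoid {p : G × G // p.1 * p.2 = h} where
  r p q := ∃ z : G, z * p.1.1 * z⁻¹ = q.1.1 ∧ z * p.1.2 * z⁻¹ = q.1.2
  iseqv :=
    { refl := fun p => ⟨1, by simp, by simp⟩
      symm := by
        rintro p q ⟨z, h1, h2⟩
        exact ⟨z⁻¹, by simp [← h1, mul_assoc], by simp [← h2, mul_assoc]⟩
      trans := by
        rintro p q r ⟨z, h1, h2⟩ ⟨w, h3, h4⟩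
        exact ⟨w * z, by simp [← h3, ← h1, mul_assoc], by simp [← h4, ← h2, mul_assoc]⟩ }

/-- The components `[m₁, m₂]` of the double inertia stack that lie over the component of `h` under
multiplication. -/
abbrev Sector (h : G) : Type u := Quotient (pairSetoid h)

/-- The first entry `m₁` of a chosen representative. -/
noncomputable def Sector.fst {h : G} (s : Sector h) : G := (Quotient.out s).1.1

/-- The second entry `m₂` of a chosen representative. -/
noncomputable def Sector.snd {h : G} (s : Sector h) : G := (Quotient.out s).1.2

theorem Sector.mul {h : G} (s : Sector h) : s.fst * s.snd = h := (Quotient.out s).2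

theorem centralizer_pair_le_left (a b : G) :
    Subgroup.centralizer {a, b} ≤ Subgroup.centralizer {a} :=
  Subgroup.centralizer_le (by simp)

theorem centralizer_pair_le_right (a b : G) :
    Subgroup.centralizer {a, b} ≤ Subgroup.centralizer {b} :=
  Subgroup.centralizer_le (by simp)

theorem centralizer_pair_le_mul {a b m : G} (h : a * b = m) :
    Subgroup.centralizer {a, b} ≤ Subgroup.centralizer {m} := by
  intro z hz
  rw [Subgroup.mem_centralizer_iff] at hz
  rw [Subgroup.mem_centralizer_singleton_iff]
  have h1 := hz a (by simp)
  have h2 := hz b (by simp)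
  rw [← h, ← mul_assoc, ← h1, mul_assoc, mul_assoc, h2]

namespace InertiaBundle
open TwistedRep
variable {β : NormalizedCocycle G k}

/-- The restriction `F_m` of the bundle to the sector of `m`, a `θ_m`-twisted representation of
`Z(m)`. -/
noncomputable def atElt (F : InertiaBundle β) (m : G) :
    TwistedRep (Subgroup.centralizer {m}) (β.θ m) :=
  (F (ConjClasses.mk m)).conj β (conjugator m) (conjugator_spec m)

noncomputable def atEltMap {F F' : InertiaBundle β} (f : F ⟶ F') (m : G) :
    F.atElt m ⟶ F'.atElt m :=
  conjMap β (conjugator m) (conjugator_spec m) (f (ConjClasses.mk m))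

/-- `e₁^*(F) ⊗^γ e₂^*(F')` on the component `[pt/Z(m₁,m₂)]` of the double inertia stack. -/
noncomputable def sectorTensor (F F' : InertiaBundle β) {h : G} (s : Sector h) :
    TwistedRep (Subgroup.centralizer {s.fst, s.snd}) (β.θ h) :=
  TwistedRep.tensor β s.mul (res (centralizer_pair_le_left _ _) (F.atElt s.fst))
    (res (centralizer_pair_le_right _ _) (F'.atElt s.snd))

noncomputable def sectorTensorMap {F₁ F₂ F₁' F₂' : InertiaBundle β} (f : F₁ ⟶ F₂) (f' : F₁' ⟶ F₂')
    {h : G} (s : Sector h) : F₁.sectorTensor F₁' s ⟶ F₂.sectorTensor F₂' s :=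
  tensorMap β s.mul (resMap _ (atEltMap f s.fst)) (resMap _ (atEltMap f' s.snd))

variable [Finite G]

/-- The push-pull product `e₃_*(e₁^*(F) ⊗^γ e₂^*(F'))`. Over the class of `h` it is the sum over the
classes of pairs with `m₁m₂ = h` of the representations induced from `Z(m₁,m₂)` to `Z(h)`; over a
point the obstruction bundle is trivial. -/
noncomputable def mul (F F' : InertiaBundle β) : InertiaBundle β := fun c =>
  TwistedRep.pi fun s : Sector (classRep c) =>
    ind (centralizer_pair_le_mul s.mul) (β.θ_isCocycleOn (classRep c)) (F.sectorTensor F' s)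

/-- The push-pull product on morphisms. -/
noncomputable def mulMap {F₁ F₂ F₁' F₂' : InertiaBundle β} (f : F₁ ⟶ F₂) (f' : F₁' ⟶ F₂') :
    F₁.mul F₁' ⟶ F₂.mul F₂' := fun c =>
  piMap fun s : Sector (classRep c) =>
    indMap (centralizer_pair_le_mul s.mul) (β.θ_isCocycleOn (classRep c)) (sectorTensorMap f f' s)

/-- The push-pull product as a functor of both variables. -/
noncomputable def pushPull (β : NormalizedCocycle G k) :
    InertiaBundle β × InertiaBundle β ⥤ InertiaBundle β where
  obj P := P.1.mul P.2
  map f := mulMap f.1 f.2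
  map_id P := by
    funext c
    apply TwistedRep.hom_ext
    refine LinearMap.ext fun v => funext fun s => Subtype.ext (funext fun x => ?_)
    exact LinearMap.congr_fun TensorProduct.map_id _
  map_comp f g := by
    funext c
    apply TwistedRep.hom_ext
    refine LinearMap.ext fun v => funext fun s => Subtype.ext (funext fun x => ?_)
    exact LinearMap.congr_fun (TensorProduct.map_comp _ _ _ _) _

open Classical in
/-- The unit: the trivial line bundle on the untwisted sector. -/
noncomputable def one (β : NormalizedCocycle G k) : InertiaBundle β := fun c =>
  if h : classRep c = 1 then
    TwistedRep.trivial (fun x y => (congrArg (fun g => β.θ g x y) h).trans (β.θ_one _ _))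
  else TwistedRep.zero

/-- Short exact sequences of bundles on the inertia stack. -/
def ShortExact (A B C : InertiaBundle β) : Prop :=
  ∃ (f : A ⟶ B) (g : B ⟶ C), ∀ c, ShortExactLin (f c).lin (g c).lin

theorem ShortExact.mul_left {A B C : InertiaBundle β} (F : InertiaBundle β)
    (h : ShortExact A B C) : ShortExact (F.mul A) (F.mul B) (F.mul C) := by
  obtain ⟨f, g, h⟩ := h
  exact ⟨mulMap (𝟙 F) f, mulMap (𝟙 F) g, fun c => piMap_exact _ _ fun s =>
    indMap_exact _ _ _ _ (h (ConjClasses.mk s.snd)).id_map⟩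

theorem ShortExact.mul_right {A B C : InertiaBundle β} (F : InertiaBundle β)
    (h : ShortExact A B C) : ShortExact (A.mul F) (B.mul F) (C.mul F) := by
  obtain ⟨f, g, h⟩ := h
  exact ⟨mulMap f (𝟙 F), mulMap g (𝟙 F), fun c => piMap_exact _ _ fun s =>
    indMap_exact _ _ _ _ (h (ConjClasses.mk s.fst)).map_id⟩

end InertiaBundle

/-- Short exact sequences of modules. -/
def RepDouble.ShortExact [Fintype G] {β : NormalizedCocycle G k} (A B C : RepDouble β) : Prop :=
  ∃ (f : A ⟶ B) (g : B ⟶ C), ShortExactLin f.lin g.lin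

/-- The free abelian group on `X` modulo `[B] = [A] + [C]` for each sequence `r A B C`. -/
def GrothendieckGroup {X : Type (u + 1)} (r : X → X → X → Prop) : Type (u + 1) :=
  FreeAbelianGroup X ⧸ AddSubgroup.closure
    {x | ∃ A B C, r A B C ∧
      x = FreeAbelianGroup.of B - FreeAbelianGroup.of A - FreeAbelianGroup.of C}

namespace GrothendieckGroup
variable {X : Type (u + 1)} {r : X → X → X → Prop}

instance : AddCommGroup (GrothendieckGroup r) :=
  inferInstanceAs (AddCommGroup (FreeAbelianGroup X ⧸ _))

def mk (r : X → X → X → Prop) (A : X) : GrothendieckGroup r :=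
  QuotientAddGroup.mk (FreeAbelianGroup.of A)

theorem mk_eq {A B C : X} (h : r A B C) : mk r B = mk r A + mk r C := by
  have : (QuotientAddGroup.mk (FreeAbelianGroup.of B - FreeAbelianGroup.of A -
      FreeAbelianGroup.of C) : GrothendieckGroup r) = 0 := by
    refine (QuotientAddGroup.eq_zero_iff _).2 (AddSubgroup.subset_closure ⟨A, B, C, h, rfl⟩)
  change mk r B - mk r A - mk r C = 0 at this
  rw [sub_sub, sub_eq_zero] at this
  exact this

def lift {M : Type (u + 1)} [AddCommGroup M] (f : X → M)
    (h : ∀ A B C, r A B C → f B = f A + f C) : GrothendieckGroup r →+ M :=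
  QuotientAddGroup.lift _ (FreeAbelianGroup.lift f) (by
    rw [AddSubgroup.closure_le]
    rintro _ ⟨A, B, C, hr, rfl⟩
    simp [h A B C hr])

@[simp] theorem lift_mk {M : Type (u + 1)} [AddCommGroup M] (f : X → M)
    (h : ∀ A B C, r A B C → f B = f A + f C) (A : X) : lift f h (mk r A) = f A :=
  FreeAbelianGroup.lift_apply_of f A

theorem hom_ext {M : Type (u + 1)} [AddCommGroup M] {f g : GrothendieckGroup r →+ M}
    (h : ∀ A, f (mk r A) = g (mk r A)) : f = g := by
  refine QuotientAddGroup.addMonoidHom_ext _ (FreeAbelianGroup.lift.symm.injective ?_)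
  funext A
  exact h A

def lift₂ (op : X → X → X) (hl : ∀ F A B C, r A B C → r (op F A) (op F B) (op F C))
    (hr : ∀ F A B C, r A B C → r (op A F) (op B F) (op C F)) :
    GrothendieckGroup r →+ GrothendieckGroup r →+ GrothendieckGroup r :=
  lift (fun F => lift (fun A => mk r (op F A)) fun A B C h => mk_eq (hl F A B C h))
    fun A B C h => hom_ext fun F => by simpa using mk_eq (hr F A B C h)

theorem lift₂_mk (op : X → X → X) (hl : ∀ F A B C, r A B C → r (op F A) (op F B) (op F C))
    (hr : ∀ F A B C, r A B C → r (op A F) (op B F) (op C F)) (A B : X) :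
    lift₂ op hl hr (mk r A) (mk r B) = mk r (op A B) := by
  simp [lift₂]

end GrothendieckGroup

/-- The `β`-twisted full K-theory of `[pt/G]`: the Grothendieck group of `β`-twisted vector bundles
on the inertia stack, with the push-pull product. -/
def KFull [Finite G] (β : NormalizedCocycle G k) : Type (u + 1) :=
  GrothendieckGroup (InertiaBundle.ShortExact (β := β))

namespace KFull
variable [Finite G] (β : NormalizedCocycle G k)

instance : AddCommGroup (KFull β) := inferInstanceAs (AddCommGroup (GrothendieckGroup _))
variable {β} in
def mk (F : InertiaBundle β) : KFull β := GrothendieckGroup.mk _ F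

noncomputable def mulHom : KFull β →+ KFull β →+ KFull β :=
  GrothendieckGroup.lift₂ InertiaBundle.mul (fun F _ _ _ h => h.mul_left F)
    (fun F _ _ _ h => h.mul_right F)

noncomputable instance : NonUnitalNonAssocRing (KFull β) :=
  { (inferInstance : AddCommGroup (KFull β)) with
    mul := fun a b => mulHom β a b
    left_distrib := fun a b c => (mulHom β a).map_add b c
    right_distrib := fun a b c => by
      change mulHom β (a + b) c = mulHom β a c + mulHom β b c
      simp
    zero_mul := fun a => by change mulHom β 0 a = 0; simp
    mul_zero := fun a => by change mulHom β a 0 = 0; simp }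

noncomputable instance : One (KFull β) := ⟨mk (InertiaBundle.one β)⟩

theorem mk_mul (F F' : InertiaBundle β) : mk F * mk F' = mk (F.mul F') := by
  exact GrothendieckGroup.lift₂_mk _ _ _ _ _

end KFull

/-- The representation ring of `D^β(k[G])`: the Grothendieck group of finite-dimensional modules, with
the tensor product of modules as product. -/
def RepRing [Fintype G] (β : NormalizedCocycle G k) : Type (u + 1) :=
  GrothendieckGroup (RepDouble.ShortExact (β := β))

namespace RepRing
variable [Fintype G] (β : NormalizedCocycle G k)

instance : AddCommGroup (RepRing β) := inferInstanceAs (AddCommGroup (GrothendieckGroup _))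
variable {β} in
def mk (A : RepDouble β) : RepRing β := GrothendieckGroup.mk _ A

noncomputable def mulHom : RepRing β →+ RepRing β →+ RepRing β :=
  GrothendieckGroup.lift₂ (fun A B : RepDouble β => A ⊗ B)
    (by
      rintro F A B C ⟨f, g, h⟩
      exact ⟨F ◁ f, F ◁ g, h.id_map⟩)
    (by
      rintro F A B C ⟨f, g, h⟩
      exact ⟨f ▷ F, g ▷ F, h.map_id⟩)

noncomputable instance : NonUnitalNonAssocRing (RepRing β) :=
  { (inferInstance : AddCommGroup (RepRing β)) with
    mul := fun a b => mulHom β a b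
    left_distrib := fun a b c => (mulHom β a).map_add b c
    right_distrib := fun a b c => by
      change mulHom β (a + b) c = mulHom β a c + mulHom β b c
      simp
    zero_mul := fun a => by change mulHom β 0 a = 0; simp
    mul_zero := fun a => by change mulHom β a 0 = 0; simp }

noncomputable instance : One (RepRing β) := ⟨mk (𝟙_ (RepDouble β))⟩

theorem mk_mul (A B : RepDouble β) : mk A * mk B = mk (A ⊗ B) := by
  exact GrothendieckGroup.lift₂_mk _ _ _ _ _

end RepRing

end TwistedDoubleDefs

/-!
The bundle of a module `M` has the homogeneous part `(g ⌊ 1) M` as its fibre over the sector of `g`;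
the elements `g ⌊ x` with `x` in the centralizer of `g` act on it by a `θ_g`-twisted representation.
Since `∑ m, m ⌊ x` carries degree `g` to degree `x g x⁻¹`, the parts over representatives of the
conjugacy classes determine `M`: the inverse functor sends a twisted representation `A` of `Z(g)` to
the functions `f : G → A` with `ρ(h) f(x) = θ_g(h,x) f(hx)`, on which `m ⌊ y` acts by right
translation twisted by `θ_g`. The cocycle identity of `θ` makes this an action.

The part of degree `g` of `M ⊗ N` is the sum of the parts of bidegree `(a, b)` with `a b = g`,
which the centralizer of `g` permutes. Its orbits are the sectors over `g`, the stabilizer of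
`(a, b)` is the common centralizer, and the coproduct is `γ` on the diagonal; so Frobenius
reciprocity identifies this part with the push-pull product. The braided structure on bundles is
the one transported along the equivalence. Both functors preserve short exact sequences, because
exactness can be tested on homogeneous parts, and the isomorphism of Grothendieck groups follows.
The associativity constraint on the regular module detects every value of `β`.
-/

section ShortExactSequences
variable {k U V W : Type u} [Field k] [AddCommGroup U] [Module k U] [AddCommGroup V] [Module k V]
  [AddCommGroup W] [Module k W]

theorem shortExactLin_congr {U' V' W' : Type u} [AddCommGroup U'] [Module k U']
    [AddCommGroup V'] [Module k V'] [AddCommGroup W'] [Module k W']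
    {f : U →ₗ[k] V} {g : V →ₗ[k] W} {f' : U' →ₗ[k] V'} {g' : V' →ₗ[k] W'}
    (eU : U ≃ₗ[k] U') (eV : V ≃ₗ[k] V') (eW : W ≃ₗ[k] W')
    (hf : f' ∘ₗ eU = eV ∘ₗ f) (hg : g' ∘ₗ eV = eW ∘ₗ g) :
    ShortExactLin f g ↔ ShortExactLin f' g' := by
  have hf' : f' ∘ eU = eV ∘ f := congrArg DFunLike.coe hf
  have hg' : g' ∘ eV = eW ∘ g := congrArg DFunLike.coe hg
  refine and_congr ?_ (and_congr (Function.Exact.iff_of_ladder_linearEquiv hf hg).symm ?_)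
  · rw [← eU.injective_comp, ← EquivLike.comp_injective f eV]
    exact iff_of_eq (congrArg _ hf'.symm)
  · rw [← eV.surjective_comp, ← EquivLike.comp_surjective g eW]
    exact iff_of_eq (congrArg _ hg'.symm)

theorem exact_piMap_iff {ι : Type*} {U V W : ι → Type*} [∀ i, AddCommGroup (U i)]
    [∀ i, Module k (U i)] [∀ i, AddCommGroup (V i)] [∀ i, Module k (V i)]
    [∀ i, AddCommGroup (W i)] [∀ i, Module k (W i)] (f : ∀ i, U i →ₗ[k] V i)
    (g : ∀ i, V i →ₗ[k] W i) :
    Function.Exact (LinearMap.piMap f) (LinearMap.piMap g) ↔ ∀ i, Function.Exact (f i) (g i) := by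
  classical
  have map_single (i : ι) (v : V i) :
      LinearMap.piMap g (Pi.single i v) = Pi.single i (g i v) :=
    funext (Pi.apply_single (fun j => g j) (fun j => map_zero (g j)) i v)
  refine ⟨fun h i v => ⟨fun hv => ?_, ?_⟩, fun h v => ?_⟩
  · obtain ⟨u, hu⟩ := (h (Pi.single i v)).1 (by rw [map_single, hv, Pi.single_zero])
    exact ⟨u i, (congrFun hu i).trans (Pi.single_eq_same i v)⟩
  · rintro ⟨u, rfl⟩
    have := congrFun (h.apply_apply_eq_zero (Pi.single i u)) i
    simpa only [LinearMap.coe_piMap, Pi.map_apply, Pi.single_eq_same, Pi.zero_apply] using this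
  · simp only [funext_iff, Set.mem_range, LinearMap.coe_piMap, Pi.map_apply, Pi.zero_apply, h _ _,
      Classical.skolem]

theorem shortExactLin_piMap_iff {ι : Type u} {U V W : ι → Type u} [∀ i, AddCommGroup (U i)]
    [∀ i, Module k (U i)] [∀ i, AddCommGroup (V i)] [∀ i, Module k (V i)]
    [∀ i, AddCommGroup (W i)] [∀ i, Module k (W i)] (f : ∀ i, U i →ₗ[k] V i)
    (g : ∀ i, V i →ₗ[k] W i) :
    ShortExactLin (LinearMap.piMap f) (LinearMap.piMap g) ↔ ∀ i, ShortExactLin (f i) (g i) := by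
  have hsurj : Function.Surjective (LinearMap.piMap g) ↔ ∀ i, Function.Surjective (g i) :=
    ⟨fun h i => ((Function.surjective_eval i).comp h).of_comp (f := g i) (g := Function.eval i),
      Function.Surjective.piMap⟩
  rw [ShortExactLin, exact_piMap_iff, hsurj, LinearMap.coe_piMap, Pi.map_injective, ← forall_and,
    ← forall_and]
  rfl

theorem shortExactLin_iff_bijective [Subsingleton U] {f : U →ₗ[k] V} {g : V →ₗ[k] W} :
    ShortExactLin f g ↔ Function.Bijective g := by
  obtain rfl : f = 0 := Subsingleton.elim _ _
  exact and_iff_right (Function.injective_of_subsingleton _) |>.trans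
    (and_congr_left' (LinearMap.exact_zero_iff_injective U g))

end ShortExactSequences

section Isomorphisms
variable {G k : Type u} [Group G] [Field k]

namespace TwistedRep
variable {H : Subgroup G} {α : G → G → kˣ} {A B : TwistedRep H α}

/-- A bijective intertwiner, as an isomorphism. -/
noncomputable def isoOfBijective (f : A ⟶ B) (hf : Function.Bijective f.lin) : A ≅ B :=
  let e := LinearEquiv.ofBijective f.lin hf
  { hom := f
    inv := ⟨e.symm, fun x v => e.injective (by
      rw [LinearEquiv.coe_coe, e.apply_symm_apply]
      exact ((f.comm x (e.symm v)).trans (congrArg (B.ρ x) (e.apply_symm_apply v))).symm)⟩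
    hom_inv_id := hom_ext (LinearMap.ext e.symm_apply_apply)
    inv_hom_id := hom_ext (LinearMap.ext e.apply_symm_apply) }

/-- The linear equivalence that underlies an isomorphism. -/
def linEquivOfIso (e : A ≅ B) : A.V ≃ₗ[k] B.V :=
  LinearEquiv.ofLinearMap e.hom.lin e.inv.lin (congrArg Hom.lin e.inv_hom_id)
    (congrArg Hom.lin e.hom_inv_id)

instance : Subsingleton (zero : TwistedRep H α).V := inferInstanceAs (Subsingleton PUnit)

end TwistedRep

variable [Fintype G] {β : NormalizedCocycle G k}

namespace RepDouble

/-- A bijective homomorphism of modules, as an isomorphism. -/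
noncomputable def isoOfBijective {A B : RepDouble β} (f : A ⟶ B)
    (hf : Function.Bijective f.lin) : A ≅ B :=
  let e := LinearEquiv.ofBijective f.lin hf
  mkIso f e.symm.toLinearMap (LinearMap.ext e.symm_apply_apply) (LinearMap.ext e.apply_symm_apply)

/-- The linear equivalence that underlies an isomorphism. -/
def linEquivOfIso {A B : RepDouble β} (e : A ≅ B) : A.V ≃ₗ[k] B.V :=
  LinearEquiv.ofLinearMap e.hom.lin e.inv.lin (congrArg Hom.lin e.inv_hom_id)
    (congrArg Hom.lin e.hom_inv_id)

end RepDouble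

/-- A family of bijective intertwiners, as an isomorphism of bundles. -/
noncomputable def InertiaBundle.isoOfBijective {F F' : InertiaBundle β} (f : F ⟶ F')
    (hf : ∀ c, Function.Bijective (f c).lin) : F ≅ F' :=
  CategoryTheory.Pi.isoMk fun c => TwistedRep.isoOfBijective (f c) (hf c)

end Isomorphisms

section Lift
variable {G k : Type u} [Group G] [Field k] [Fintype G] {β : NormalizedCocycle G k}

namespace TwistedDouble
variable {A : Type*} [Ring A] [Algebra k A]

open Classical in
/-- The algebra homomorphism `g ⌊ x ↦ T g x` out of the twisted double, for a family `T` that obeys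
the relations of the basis. -/
noncomputable def lift (T : G → G → A) (one : ∑ g, T g 1 = 1)
    (mul : ∀ g x h y,
      T g x * T h y = if g = x * h * x⁻¹ then (β.θ g x y : k) • T g (x * y) else 0) :
    TwistedDouble β →ₐ[k] A :=
  AlgHom.ofLinearMap ((basis β).constr k fun p => T p.1 p.2)
    (by simp only [one_def, map_sum, elt, Module.Basis.constr_basis, one])
    (by
      intro a b
      induction a using induction with
      | zero => simp only [zero_mul, map_zero]
      | add a a' h h' => simp only [add_mul, map_add, h, h']
      | smul r g x =>
        induction b using induction with
        | zero => simp only [mul_zero, map_zero]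
        | add a a' h h' => simp only [mul_add, map_add, h, h']
        | smul r' h y =>
          simp only [smul_mul_assoc, mul_smul_comm, map_smul, elt_mul_elt, apply_ite, map_zero]
          simp only [elt, Module.Basis.constr_basis, mul, smul_ite, smul_zero])

theorem lift_elt (T : G → G → A) (one mul) (g x : G) :
    lift (β := β) T one mul (elt β g x) = T g x :=
  (basis β).constr_basis k (fun p => T p.1 p.2) (g, x)

theorem sumElt_mul_elt (x g y : G) :
    sumElt β x * elt β g y = (β.θ (x * g * x⁻¹) x y : k) • elt β (x * g * x⁻¹) (x * y) := by
  classical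
  simp [sumElt, Finset.sum_mul, elt_mul_elt]

theorem elt_mul_sumElt (g x y : G) :
    elt β g x * sumElt β y = (β.θ g x y : k) • elt β g (x * y) := by
  classical
  have hg (h : G) : g = x * h * x⁻¹ ↔ h = x⁻¹ * g * x := by
    rw [eq_mul_inv_iff_mul_eq, eq_comm, ← eq_inv_mul_iff_mul_eq, mul_assoc]
  simp [sumElt, Finset.mul_sum, elt_mul_elt, hg]

end TwistedDouble
end Lift

section HomogeneousParts
variable {G k : Type u} [Group G] [Field k]

theorem conj_eq_of_mem_centralizer {g z : G} (hz : z ∈ Subgroup.centralizer {g}) :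
    z * g * z⁻¹ = g :=
  mul_inv_eq_of_eq_mul (Subgroup.mem_centralizer_singleton_iff.1 hz)

variable [Fintype G] {β : NormalizedCocycle G k}

namespace RepDouble
open TwistedDouble

theorem φ_ρ_elt (M : RepDouble β) (x g y : G) (v : M.V) :
    M.φ x (M.ρ (elt β g y) v) =
      (β.θ (x * g * x⁻¹) x y : k) • M.ρ (elt β (x * g * x⁻¹) (x * y)) v := by
  rw [φ, ← Module.End.mul_apply, ← map_mul, sumElt_mul_elt, map_smul]
  rfl

theorem ρ_elt_φ (M : RepDouble β) (g x y : G) (v : M.V) :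
    M.ρ (elt β g x) (M.φ y v) = (β.θ g x y : k) • M.ρ (elt β g (x * y)) v := by
  rw [φ, ← Module.End.mul_apply, ← map_mul, elt_mul_sumElt, map_smul]
  rfl

theorem proj_φ (M : RepDouble β) (g x : G) (v : M.V) :
    M.ρ (elt β (x * g * x⁻¹) 1) (M.φ x v) = M.φ x (M.ρ (elt β g 1) v) := by
  rw [ρ_elt_φ, φ_ρ_elt, NormalizedCocycle.θ_one_left, NormalizedCocycle.θ_one_right, one_mul,
    mul_one]

theorem φ_inv_φ {M : RepDouble β} {h : G} {v : M.V} (hv : M.Homog h v) (x : G) :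
    M.φ x⁻¹ (M.φ x v) = (β.θ h x⁻¹ x : k) • v := by
  simpa only [inv_mul_cancel, one_mul, inv_one, mul_one, φ_one, Module.End.one_apply]
    using φ_φ hv x⁻¹ x

theorem φ_injective (M : RepDouble β) (x : G) : Function.Injective (M.φ x) := by
  rw [injective_iff_map_eq_zero]
  intro v hv
  rw [← M.sum_proj v]
  refine Finset.sum_eq_zero fun g _ => ?_
  have h := φ_inv_φ (M.homog_proj g v) x
  rw [← proj_φ, hv, map_zero, map_zero] at h
  exact (smul_eq_zero.1 h.symm).resolve_left (Units.ne_zero _)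

theorem φ_bijective (M : RepDouble β) (x : G) : Function.Bijective (M.φ x) :=
  ⟨M.φ_injective x, LinearMap.injective_iff_surjective.1 (M.φ_injective x)⟩

theorem homog_φ_iff {M : RepDouble β} {g x : G} {v : M.V} :
    M.Homog (x * g * x⁻¹) (M.φ x v) ↔ M.Homog g v := by
  rw [Homog, Homog, proj_φ, (M.φ_injective x).eq_iff]

/-- The homogeneous part of degree `g`. -/
noncomputable def degSub (M : RepDouble β) (g : G) : Submodule k M.V :=
  LinearMap.eqLocus (M.ρ (elt β g 1)) LinearMap.id

/-- The homogeneous part of degree `g`, as a twisted representation of the centralizer of `g`. -/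
noncomputable def deg (M : RepDouble β) (g : G) :
    TwistedRep (Subgroup.centralizer {g}) (β.θ g) :=
  let ρ (z : Subgroup.centralizer {g}) : Module.End k (M.degSub g) :=
    (M.φ z).restrict fun v (hv : M.Homog g v) => by
      have h := homog_φ hv (z : G)
      rwa [conj_eq_of_mem_centralizer z.2] at h
  have ρ_mul (z w) : ρ z * ρ w = (β.θ g z w : k) • ρ (z * w) :=
    LinearMap.ext fun v => Subtype.ext <| by
      have h := φ_φ (A := M) v.2 (z : G) w
      rwa [← Subgroup.coe_mul, conj_eq_of_mem_centralizer (z * w).2] at h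
  { V := M.degSub g
    ρ := ρ
    isUnit_ρ := TwistedRep.isUnit_of_one ρ (LinearMap.ext fun v => Subtype.ext (M.φ_one v)) ρ_mul
    ρ_mul := ρ_mul }

/-- The inclusion of the homogeneous part of degree `g`. -/
noncomputable def degIncl (M : RepDouble β) (g : G) : (M.deg g).V →ₗ[k] M.V :=
  (M.degSub g).subtype

theorem degIncl_injective (M : RepDouble β) (g : G) : Function.Injective (M.degIncl g) :=
  (M.degSub g).subtype_injective

theorem homog_degIncl (M : RepDouble β) {g : G} (v : (M.deg g).V) : M.Homog g (M.degIncl g v) :=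
  v.2

theorem exists_degIncl_eq {M : RepDouble β} {g : G} {v : M.V} (hv : M.Homog g v) :
    ∃ w, M.degIncl g w = v :=
  ⟨⟨v, hv⟩, rfl⟩

theorem homog_elt (M : RepDouble β) (g x : G) (v : M.V) : M.Homog g (M.ρ (elt β g x) v) := by
  rw [Homog, ← Module.End.mul_apply, ← map_mul, elt_mul_elt, one_mul, inv_one, mul_one, one_mul,
    if_pos rfl, NormalizedCocycle.θ_one_left, Units.val_one, one_smul]

/-- The action of `g ⌊ x`, as a map to the homogeneous part of degree `g`. -/
noncomputable def degElt (M : RepDouble β) (g x : G) : M.V →ₗ[k] (M.deg g).V :=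
  (M.ρ (elt β g x)).codRestrict (M.degSub g) (M.homog_elt g x)

/-- The projection to the homogeneous part of degree `g`. -/
noncomputable def degProj (M : RepDouble β) (g : G) : M.V →ₗ[k] (M.deg g).V :=
  M.degElt g 1

theorem degIncl_degProj (M : RepDouble β) (g : G) (v : M.V) :
    M.degIncl g (M.degProj g v) = M.ρ (elt β g 1) v := rfl

theorem degProj_degIncl (M : RepDouble β) {g : G} (v : (M.deg g).V) :
    M.degProj g (M.degIncl g v) = v :=
  M.degIncl_injective g (M.homog_degIncl v)

theorem degProj_eq_zero {M : RepDouble β} {g h : G} {v : M.V} (hv : M.Homog g v) (hgh : h ≠ g) :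
    M.degProj h v = 0 := by
  classical
  apply M.degIncl_injective
  rw [degIncl_degProj, homog_proj_eq hv, if_neg hgh, map_zero]

/-- A module is the direct sum of its homogeneous parts. -/
noncomputable def degEquiv (M : RepDouble β) : M.V ≃ₗ[k] ∀ g, (M.deg g).V :=
  LinearEquiv.ofLinearMap (LinearMap.pi M.degProj) (∑ g, M.degIncl g ∘ₗ LinearMap.proj g)
    (LinearMap.ext fun v => funext fun g => by
      classical
      simp only [LinearMap.comp_apply, LinearMap.pi_apply, LinearMap.sum_apply, map_sum,
        LinearMap.proj_apply, LinearMap.id_apply]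
      rw [Finset.sum_eq_single g
        (fun h _ hh => degProj_eq_zero (M.homog_degIncl (v h)) hh.symm)
        (fun hg => absurd (Finset.mem_univ g) hg), degProj_degIncl])
    (LinearMap.ext fun v => by
      simp only [LinearMap.comp_apply, LinearMap.pi_apply, LinearMap.sum_apply,
        LinearMap.proj_apply, LinearMap.id_apply, degIncl_degProj, sum_proj])

/-- The intertwiner that a homomorphism of modules induces in degree `g`. -/
noncomputable def degMap {M N : RepDouble β} (f : M ⟶ N) (g : G) : M.deg g ⟶ N.deg g where
  lin := f.lin.restrict (p := M.degSub g) (q := N.degSub g) fun _ => Homog.map f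
  comm z _ := Subtype.ext (hom_φ f z _)

theorem degMap_degProj {M N : RepDouble β} (f : M ⟶ N) (g : G) (v : M.V) :
    (degMap f g).lin (M.degProj g v) = N.degProj g (f.lin v) :=
  N.degIncl_injective g (f.comm _ v)

/-- The isomorphism `v ↦ (∑ₕ h ⌊ x) v` between the homogeneous parts of degrees `g` and
`m = xgx⁻¹`. -/
noncomputable def degConj (M : RepDouble β) {g m : G} (x : G) (hm : m = x * g * x⁻¹) :
    (M.deg g).conj β x hm ⟶ M.deg m where
  lin := (M.φ x).restrict (p := M.degSub g) (q := M.degSub m) fun _ hv =>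
    hm ▸ homog_φ hv x
  comm z v := M.degIncl_injective m <| by
    have hv : M.Homog g (M.degIncl g v) := M.homog_degIncl v
    have hzx : (z : G) * x * g * ((z : G) * x)⁻¹ = m := by
      rw [mul_inv_rev, ← mul_assoc, mul_assoc (z : G), mul_assoc (z : G), ← hm,
        conj_eq_of_mem_centralizer z.2]
    have hxz : x * (x⁻¹ * z * x) = z * x := by rw [mul_assoc, mul_inv_cancel_left]
    have hz := φ_φ hv (z : G) x
    have hx := φ_φ hv x (x⁻¹ * z * x)
    rw [hzx] at hz
    rw [hxz, hzx] at hx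
    refine (M.φ x).map_smul _ _ |>.trans ((congrArg _ hx).trans (Eq.trans ?_ hz.symm))
    rw [smul_smul, ← Units.val_mul, div_mul_cancel]

theorem degConj_bijective (M : RepDouble β) {g m : G} (x : G) (hm : m = x * g * x⁻¹) :
    Function.Bijective (M.degConj x hm).lin := by
  subst hm
  refine ⟨fun v w h => M.degIncl_injective g (M.φ_injective x (congrArg Subtype.val h)),
    fun v => ?_⟩
  obtain ⟨w, hw⟩ := (M.φ_bijective x).2 (M.degIncl _ v)
  exact ⟨⟨w, homog_φ_iff.1 (hw ▸ M.homog_degIncl v)⟩, Subtype.ext hw⟩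

theorem degMap_degConj {M N : RepDouble β} (f : M ⟶ N) {g m : G} (x : G)
    (hm : m = x * g * x⁻¹) :
    M.degConj x hm ≫ degMap f m = TwistedRep.conjMap β x hm (degMap f g) ≫ N.degConj x hm :=
  TwistedRep.hom_ext (LinearMap.ext fun _ => Subtype.ext (hom_φ f x _))

theorem shortExactLin_iff_degMap {A B C : RepDouble β} (f : A ⟶ B) (g : B ⟶ C) :
    ShortExactLin f.lin g.lin ↔ ∀ m, ShortExactLin (degMap f m).lin (degMap g m).lin :=
  (shortExactLin_congr A.degEquiv B.degEquiv C.degEquiv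
    (LinearMap.ext fun v => funext fun m => degMap_degProj f m v)
    (LinearMap.ext fun v => funext fun m => degMap_degProj g m v)).trans
    (shortExactLin_piMap_iff _ _)

theorem shortExactLin_degMap_conj_iff {A B C : RepDouble β} (f : A ⟶ B) (g : B ⟶ C) {h m : G}
    (x : G) (hm : m = x * h * x⁻¹) :
    ShortExactLin (degMap f h).lin (degMap g h).lin ↔
      ShortExactLin (degMap f m).lin (degMap g m).lin :=
  shortExactLin_congr (LinearEquiv.ofBijective _ (A.degConj_bijective x hm))
    (LinearEquiv.ofBijective _ (B.degConj_bijective x hm))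
    (LinearEquiv.ofBijective _ (C.degConj_bijective x hm))
    (congrArg TwistedRep.Hom.lin (degMap_degConj f x hm))
    (congrArg TwistedRep.Hom.lin (degMap_degConj g x hm))

/-- The bundle on the inertia stack formed by the homogeneous parts of a module. -/
noncomputable def toBundle (β : NormalizedCocycle G k) : RepDouble β ⥤ InertiaBundle β where
  obj M c := M.deg (classRep c)
  map f c := degMap f (classRep c)

theorem shortExactLin_iff_toBundle {A B C : RepDouble β} (f : A ⟶ B) (g : B ⟶ C) :
    ShortExactLin f.lin g.lin ↔
      ∀ c, ShortExactLin ((toBundle β).map f c).lin ((toBundle β).map g c).lin := by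
  refine (shortExactLin_iff_degMap f g).trans ⟨fun h c => h (classRep c), fun h m => ?_⟩
  exact (shortExactLin_degMap_conj_iff f g (conjugator m) (conjugator_spec m)).1
    (h (ConjClasses.mk m))

/-- The zero module. -/
noncomputable def zero : RepDouble β where
  V := PUnit
  ρ := AlgHom.ofLinearMap 0 (Subsingleton.elim _ _) fun _ _ => Subsingleton.elim _ _

instance : Subsingleton (zero : RepDouble β).V := inferInstanceAs (Subsingleton PUnit)

instance (g : G) : Subsingleton ((zero : RepDouble β).deg g).V :=
  (zero.degIncl_injective g).subsingleton

theorem bijective_iff_toBundle {A B : RepDouble β} (f : A ⟶ B) :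
    Function.Bijective f.lin ↔ ∀ c, Function.Bijective ((toBundle β).map f c).lin := by
  let i : zero ⟶ A := ⟨0, fun _ _ => (map_zero _).symm⟩
  have (c : ConjClasses G) : Subsingleton ((toBundle β).obj zero c).V :=
    inferInstanceAs (Subsingleton (zero.deg (classRep c)).V)
  rw [← shortExactLin_iff_bijective (f := i.lin), shortExactLin_iff_toBundle]
  exact forall_congr' fun c => shortExactLin_iff_bijective

end RepDouble
end HomogeneousParts

section ModuleOfBundle
variable {G k : Type u} [Group G] [Field k]

namespace TwistedRep
variable {H : Subgroup G} {α : G → G → kˣ}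

theorem ρ_ρ (A : TwistedRep H α) (x y : H) (v : A.V) :
    A.ρ x (A.ρ y v) = (α x y : k) • A.ρ (x * y) v :=
  LinearMap.congr_fun (A.ρ_mul x y) v

theorem ρ_bijective (A : TwistedRep H α) (x : H) : Function.Bijective (A.ρ x) :=
  (Module.End.isUnit_iff _).1 (A.isUnit_ρ x)

theorem ρ_one (A : TwistedRep H α) (hα : α 1 1 = 1) (v : A.V) : A.ρ 1 v = v := by
  apply (A.ρ_bijective 1).1
  rw [ρ_ρ, mul_one, Subgroup.coe_one, hα, Units.val_one, one_smul]

/-- The space of functions `f : G → A` with `ρ(h) f(x) = α(h,x) f(hx)` for `h ∈ H`. -/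
def equivariant (A : TwistedRep H α) : Submodule k (G → A.V) where
  carrier := {f | ∀ (h : H) (x : G), A.ρ h (f x) = (α h x : k) • f (h * x)}
  add_mem' hf hg h x := by simp only [Pi.add_apply, map_add, smul_add, hf h x, hg h x]
  zero_mem' h x := by simp only [Pi.zero_apply, map_zero, smul_zero]
  smul_mem' c f hf h x := by simp only [Pi.smul_apply, map_smul, hf h x, smul_comm c]

open Classical in
/-- The equivariant function with support in `H` and value `v` at `1`. -/
noncomputable def extendByZero (A : TwistedRep H α) (v : A.V) : A.equivariant :=
  ⟨fun x => if hx : x ∈ H then A.ρ ⟨x, hx⟩ v else 0, fun h x => by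
    dsimp only
    by_cases hx : x ∈ H
    · rw [dif_pos hx, dif_pos (H.mul_mem h.2 hx)]
      exact A.ρ_ρ h ⟨x, hx⟩ v
    · rw [dif_neg hx, dif_neg (mt (H.mul_mem_cancel_left h.2).1 hx), map_zero, smul_zero]⟩

theorem extendByZero_one (A : TwistedRep H α) (hα : α 1 1 = 1) (v : A.V) :
    (A.extendByZero v).1 1 = v :=
  (dif_pos H.one_mem).trans (A.ρ_one hα v)

theorem extendByZero_eq_zero (A : TwistedRep H α) (v : A.V) {x : G} (hx : x ∉ H) :
    (A.extendByZero v).1 x = 0 :=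
  dif_neg hx

theorem equivariant_apply_eq (A : TwistedRep H α) (f : A.equivariant) (h : H) (hα : α h 1 = 1) :
    f.1 h = A.ρ h (f.1 1) := by
  rw [f.2 h 1, hα, Units.val_one, one_smul, mul_one]

/-- The map of equivariant functions that an intertwiner induces. -/
def equivariantMap {A B : TwistedRep H α} (f : A ⟶ B) : A.equivariant →ₗ[k] B.equivariant :=
  (f.lin.compLeft G).restrict fun s hs h x => by
    simp only [LinearMap.compLeft_apply, Function.comp_apply, ← f.comm, hs h x, map_smul]

variable {β : NormalizedCocycle G k} {g : G} (A : TwistedRep (Subgroup.centralizer {g}) (β.θ g))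

theorem conj_mul_of_mem_centralizer {h : G} (hh : h ∈ Subgroup.centralizer {g}) (x : G) :
    (h * x)⁻¹ * g * (h * x) = x⁻¹ * g * x := by
  calc (h * x)⁻¹ * g * (h * x) = x⁻¹ * (h⁻¹ * g * h) * x := by group
    _ = x⁻¹ * g * x := by rw [NormalizedCocycle.conj_of_mem hh]

open Classical in
/-- The action of `m ⌊ y` on equivariant functions: `f ↦ (x ↦ θ_g(x,y) f(xy))` where
`x⁻¹gx = m`, and `0` elsewhere. -/
noncomputable def equivariantAct (m y : G) : Module.End k A.equivariant where
  toFun f := ⟨fun x => if x⁻¹ * g * x = m then (β.θ g x y : k) • f.1 (x * y) else 0, fun h x => by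
    simp only [conj_mul_of_mem_centralizer h.2 x]
    split_ifs
    · have hθ := congrArg Units.val (β.θ_cocycle g h x y)
      rw [NormalizedCocycle.conj_of_mem h.2, Units.val_mul, Units.val_mul] at hθ
      rw [map_smul, f.2 h (x * y), smul_smul, smul_smul, mul_assoc, hθ, mul_comm]
    · rw [map_zero, smul_zero]⟩
  map_add' f f' := Subtype.ext <| funext fun x => by
    simp only [Submodule.coe_add, Pi.add_apply, smul_add, ite_add_zero]
  map_smul' a f := Subtype.ext <| funext fun x => by
    simp only [Submodule.coe_smul, Pi.smul_apply, RingHom.id_apply, smul_ite, smul_zero,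
      smul_comm a]

open Classical in
theorem equivariantAct_apply (m y : G) (f : A.equivariant) (x : G) :
    (A.equivariantAct m y f).1 x =
      if x⁻¹ * g * x = m then (β.θ g x y : k) • f.1 (x * y) else 0 := rfl

open Classical in
theorem equivariantAct_mul (m y n z : G) :
    A.equivariantAct m y * A.equivariantAct n z =
      if m = y * n * y⁻¹ then (β.θ m y z : k) • A.equivariantAct m (y * z) else 0 := by
  refine LinearMap.ext fun f => Subtype.ext (funext fun x => ?_)
  have hxy : (x * y)⁻¹ * g * (x * y) = n ↔ x⁻¹ * g * x = y * n * y⁻¹ := by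
    rw [eq_mul_inv_iff_mul_eq, ← inv_mul_eq_iff_eq_mul]
    simp only [mul_inv_rev, mul_assoc]
  rw [Module.End.mul_apply, equivariantAct_apply, equivariantAct_apply, hxy]
  by_cases hm : x⁻¹ * g * x = m
  · rw [if_pos hm, hm]
    split_ifs with h
    · have hθ := congrArg Units.val (β.θ_cocycle g x y z)
      rw [hm, Units.val_mul, Units.val_mul] at hθ
      change _ = (β.θ m y z : k) • (A.equivariantAct m (y * z) f).1 x
      rw [equivariantAct_apply, if_pos hm, smul_smul, smul_smul, hθ, mul_assoc,
        mul_comm (β.θ m y z : k)]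
    · exact smul_zero _
  · rw [if_neg hm]
    split_ifs
    · change _ = (β.θ m y z : k) • (A.equivariantAct m (y * z) f).1 x
      rw [equivariantAct_apply, if_neg hm, smul_zero]
    · rfl

theorem sum_equivariantAct [Fintype G] (y : G) (f : A.equivariant) (x : G) :
    (∑ m, A.equivariantAct m y f).1 x = (β.θ g x y : k) • f.1 (x * y) := by
  classical
  simp only [AddSubmonoidClass.coe_finsetSum, Finset.sum_apply, equivariantAct_apply,
    Finset.sum_ite_eq, Finset.mem_univ, if_true]

end TwistedRep

variable {β : NormalizedCocycle G k}

namespace InertiaBundle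
open TwistedDouble TwistedRep

/-- The underlying space of the module of a bundle. -/
abbrev Total (F : InertiaBundle β) : Type u := ∀ c, (F c).equivariant

/-- The action of `m ⌊ y` on the module of a bundle. -/
noncomputable def totalAct (F : InertiaBundle β) (m y : G) : Module.End k F.Total :=
  LinearMap.piMap fun c => (F c).equivariantAct m y

open Classical in
theorem totalAct_mul (F : InertiaBundle β) (m y n z : G) :
    F.totalAct m y * F.totalAct n z =
      if m = y * n * y⁻¹ then (β.θ m y z : k) • F.totalAct m (y * z) else 0 :=
  LinearMap.ext fun f => funext fun c => by
    refine (LinearMap.congr_fun ((F c).equivariantAct_mul m y n z) (f c)).trans ?_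
    split_ifs <;> rfl

/-- The linear map of modules that a morphism of bundles induces. -/
noncomputable def totalMap {F F' : InertiaBundle β} (a : F ⟶ F') : F.Total →ₗ[k] F'.Total :=
  LinearMap.piMap fun c => equivariantMap (a c)

variable [Fintype G]

theorem sum_totalAct (F : InertiaBundle β) (y : G) (f : F.Total) (c : ConjClasses G) (x : G) :
    ((∑ m, F.totalAct m y) f c).1 x = (β.θ (classRep c) x y : k) • (f c).1 (x * y) := by
  rw [LinearMap.sum_apply, Finset.sum_apply]
  exact (F c).sum_equivariantAct y (f c) x

theorem sum_totalAct_one (F : InertiaBundle β) : ∑ m, F.totalAct m 1 = 1 :=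
  LinearMap.ext fun f => funext fun c => Subtype.ext <| funext fun x => by
    rw [sum_totalAct, NormalizedCocycle.θ_one_right, mul_one]
    exact one_smul _ _

/-- The module of a bundle. -/
noncomputable def toModule (F : InertiaBundle β) : RepDouble β where
  V := F.Total
  ρ := lift F.totalAct F.sum_totalAct_one F.totalAct_mul

theorem toModule_elt (F : InertiaBundle β) (m y : G) :
    F.toModule.ρ (elt β m y) = F.totalAct m y :=
  lift_elt _ F.sum_totalAct_one F.totalAct_mul m y

open Classical in
theorem toModule_elt_apply (F : InertiaBundle β) (m y : G) (f : F.Total) (c : ConjClasses G)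
    (x : G) : ((F.toModule.ρ (elt β m y) f : F.Total) c).1 x =
      if x⁻¹ * classRep c * x = m then (β.θ (classRep c) x y : k) • (f c).1 (x * y) else 0 := by
  rw [toModule_elt]
  rfl

theorem toModule_φ (F : InertiaBundle β) (y : G) (f : F.Total) (c : ConjClasses G) (x : G) :
    ((F.toModule.φ y f : F.Total) c).1 x = (β.θ (classRep c) x y : k) • (f c).1 (x * y) := by
  rw [← F.sum_totalAct, RepDouble.φ, sumElt, map_sum]
  simp only [toModule_elt]
  rfl

theorem toModule_homog_iff (F : InertiaBundle β) (m : G) (f : F.Total) :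
    F.toModule.Homog m f ↔ ∀ c x, x⁻¹ * classRep c * x ≠ m → (f c).1 x = 0 := by
  classical
  have homog_iff : F.toModule.Homog m f ↔
      ∀ c x, ((F.toModule.ρ (elt β m 1) f : F.Total) c).1 x = (f c).1 x :=
    ⟨fun h c x => congrArg (fun f : F.Total => (f c).1 x) h,
      fun h => funext fun c => Subtype.ext (funext (h c))⟩
  rw [homog_iff]
  refine forall₂_congr fun c x => ?_
  rw [toModule_elt_apply, NormalizedCocycle.θ_one_right, Units.val_one, one_smul, mul_one,
    ite_eq_left_iff, eq_comm (a := 0)]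

/-- The module of a bundle on the inertia stack, as a functor. -/
noncomputable def toDouble (β : NormalizedCocycle G k) : InertiaBundle β ⥤ RepDouble β where
  obj F := F.toModule
  map {F F'} a := RepDouble.mkHom (A := F.toModule) (B := F'.toModule)
    (totalMap a) fun m y f => funext fun c => Subtype.ext <| funext fun x => by
      refine (congrArg (a c).lin (F.toModule_elt_apply m y f c x)).trans ?_
      rw [apply_ite (a c).lin, map_smul, map_zero]
      exact (F'.toModule_elt_apply m y (totalMap a f) c x).symm

theorem toDouble_map_smul {F F' : InertiaBundle β} (a : k) (f f' : F ⟶ F')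
    (h : ∀ c, (f' c).lin = a • (f c).lin) :
    ((toDouble β).map f').lin = a • ((toDouble β).map f).lin :=
  LinearMap.ext fun v => funext fun c => Subtype.ext <| funext fun x =>
    LinearMap.congr_fun (h c) ((v c).1 x)

end InertiaBundle
end ModuleOfBundle

section EquivalenceOfCategories
variable {G k : Type u} [Group G] [Field k]

theorem eq_of_conj_classRep_eq {c d : ConjClasses G} {x : G}
    (h : x⁻¹ * classRep d * x = classRep c) : d = c := by
  rw [← mk_classRep d, ← mk_classRep c, ConjClasses.mk_eq_mk_iff_isConj, isConj_iff]
  exact ⟨x⁻¹, by rwa [inv_inv]⟩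

theorem mem_centralizer_iff_conj_eq {g x : G} :
    x ∈ Subgroup.centralizer {g} ↔ x⁻¹ * g * x = g := by
  rw [Subgroup.mem_centralizer_singleton_iff, mul_assoc, inv_mul_eq_iff_eq_mul, eq_comm]

variable [Fintype G] {β : NormalizedCocycle G k}

namespace InertiaBundle
open TwistedDouble TwistedRep

/-- Evaluation at `1`, from the homogeneous part of the module of a bundle to the bundle. -/
noncomputable def evalOne (F : InertiaBundle β) (c : ConjClasses G) :
    F.toModule.deg (classRep c) ⟶ F c where
  lin := LinearMap.proj (1 : G) ∘ₗ (F c).equivariant.subtype ∘ₗ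
    (LinearMap.proj c : F.Total →ₗ[k] (F c).equivariant) ∘ₗ F.toModule.degIncl (classRep c)
  comm z f := by
    let f' : F.Total := F.toModule.degIncl (classRep c) f
    refine (F.toModule_φ z f' c 1).trans ?_
    rw [NormalizedCocycle.θ_one_left, Units.val_one, one_smul, one_mul]
    exact (F c).equivariant_apply_eq (f' c) z (β.θ_one_right _ _)

theorem evalOne_apply (F : InertiaBundle β) (c : ConjClasses G)
    (f : (F.toModule.deg (classRep c)).V) :
    (F.evalOne c).lin f = ((F.toModule.degIncl (classRep c) f : F.Total) c).1 1 := rfl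

theorem evalOne_injective (F : InertiaBundle β) (c : ConjClasses G) :
    Function.Injective (F.evalOne c).lin := by
  rw [injective_iff_map_eq_zero]
  intro f hf
  rw [evalOne_apply] at hf
  have supp := (F.toModule_homog_iff (classRep c) _).1 (F.toModule.homog_degIncl f)
  apply F.toModule.degIncl_injective
  rw [map_zero]
  refine funext fun d => Subtype.ext (funext fun x => ?_)
  by_cases hx : x⁻¹ * classRep d * x = classRep c
  · obtain rfl := eq_of_conj_classRep_eq hx
    refine ((F d).equivariant_apply_eq _ ⟨x, mem_centralizer_iff_conj_eq.2 hx⟩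
      (β.θ_one_right _ _)).trans ?_
    rw [hf, map_zero]
    rfl
  · exact supp d x hx

theorem evalOne_surjective (F : InertiaBundle β) (c : ConjClasses G) :
    Function.Surjective (F.evalOne c).lin := by
  classical
  intro v
  let f : F.Total := Pi.single c ((F c).extendByZero v)
  have hfc : f c = (F c).extendByZero v := Pi.single_eq_same c _
  have hf : F.toModule.Homog (classRep c) f := by
    rw [toModule_homog_iff]
    intro d x hx
    obtain rfl | hd := eq_or_ne d c
    · rw [hfc, (F d).extendByZero_eq_zero v (mt mem_centralizer_iff_conj_eq.1 hx)]
    · have hfd : f d = 0 := Pi.single_eq_of_ne hd _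
      rw [hfd]
      rfl
  obtain ⟨f', hf'⟩ := RepDouble.exists_degIncl_eq hf
  refine ⟨f', ?_⟩
  rw [evalOne_apply, hf', hfc, extendByZero_one _ (β.θ_one_right _ _)]

/-- The homogeneous parts of the module of a bundle recover the bundle. -/
noncomputable def counitIso (β : NormalizedCocycle G k) :
    toDouble β ⋙ RepDouble.toBundle β ≅ 𝟭 _ :=
  NatIso.ofComponents (fun F => isoOfBijective (fun c => F.evalOne c) fun c =>
    ⟨F.evalOne_injective c, F.evalOne_surjective c⟩) fun _ => rfl

end InertiaBundle

namespace RepDouble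
open TwistedDouble InertiaBundle

/-- The map `v ↦ (x ↦ (g ⌊ x) v)` from a module to the equivariant functions with values in its
homogeneous part of degree `g`. -/
noncomputable def toEquivariant (M : RepDouble β) (g : G) : M.V →ₗ[k] (M.deg g).equivariant :=
  (LinearMap.pi fun x => M.degElt g x).codRestrict _ fun v h x => M.degIncl_injective _ <| by
    refine (M.φ_ρ_elt h g x v).trans ?_
    rw [conj_eq_of_mem_centralizer h.2]
    rfl

theorem toEquivariant_ρ (M : RepDouble β) (g m y : G) (v : M.V) :
    M.toEquivariant g (M.ρ (elt β m y) v) = (M.deg g).equivariantAct m y (M.toEquivariant g v) := by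
  classical
  refine Subtype.ext (funext fun x => M.degIncl_injective g ?_)
  have hm : g = x * m * x⁻¹ ↔ x⁻¹ * g * x = m := by
    rw [eq_mul_inv_iff_mul_eq, mul_assoc, inv_mul_eq_iff_eq_mul]
  refine (LinearMap.congr_fun (map_mul M.ρ _ _).symm v).trans ?_
  rw [elt_mul_elt, TwistedRep.equivariantAct_apply, hm, apply_ite (M.degIncl g)]
  split_ifs
  · rw [map_smul]
    rfl
  · rw [map_zero, map_zero]
    rfl

/-- The homomorphism from a module to the module of its bundle. -/
noncomputable def toTotal (M : RepDouble β) : M ⟶ ((toBundle β).obj M).toModule :=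
  mkHom (A := M) (B := ((toBundle β).obj M).toModule)
    (LinearMap.pi fun c => M.toEquivariant (classRep c)) fun m y v => by
      rw [toModule_elt]
      exact funext fun c => M.toEquivariant_ρ (classRep c) m y v

theorem evalOne_toTotal (M : RepDouble β) (c : ConjClasses G) :
    (toBundle β).map M.toTotal c ≫ ((toBundle β).obj M).evalOne c = 𝟙 (M.deg (classRep c)) :=
  TwistedRep.hom_ext (LinearMap.ext fun v => M.degIncl_injective _ (M.homog_degIncl v))

theorem toTotal_bijective (M : RepDouble β) : Function.Bijective M.toTotal.lin := by
  refine (bijective_iff_toBundle _).2 fun c => ?_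
  have evalOne_bijective : Function.Bijective (((toBundle β).obj M).evalOne c).lin :=
    ⟨evalOne_injective _ c, evalOne_surjective _ c⟩
  refine (evalOne_bijective.of_comp_iff' _).1 ?_
  exact (congrArg (fun f => Function.Bijective f.lin) (M.evalOne_toTotal c)).mpr
    Function.bijective_id

/-- A module is recovered from its bundle. -/
noncomputable def unitIso (β : NormalizedCocycle G k) : 𝟭 _ ≅ toBundle β ⋙ toDouble β :=
  NatIso.ofComponents (fun M => isoOfBijective M.toTotal M.toTotal_bijective) fun {_ N} f =>
    hom_ext <| LinearMap.ext fun v => funext fun _ => Subtype.ext <| funext fun _ =>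
      N.degIncl_injective _ (f.comm _ v).symm

end RepDouble

/-- Bundles on the inertia stack are equivalent to modules over the twisted double. -/
noncomputable def bundleEquivalence (β : NormalizedCocycle G k) : InertiaBundle β ≌ RepDouble β :=
  CategoryTheory.Equivalence.mk (InertiaBundle.toDouble β) (RepDouble.toBundle β)
    (InertiaBundle.counitIso β).symm (RepDouble.unitIso β).symm

end EquivalenceOfCategories

section FrobeniusReciprocity
variable {G k : Type u} [Group G] [Field k] {H K : Subgroup G} {α : G → G → kˣ}

namespace TwistedRep

/-- The intertwiner to a direct sum with given components. -/
def piLift {ι : Type u} [Finite ι] {V : TwistedRep K α} {A : ι → TwistedRep K α}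
    (f : ∀ i, V ⟶ A i) : V ⟶ pi A where
  lin := LinearMap.pi fun i => (f i).lin
  comm x v := funext fun i => (f i).comm x v

theorem ρ_eq_smul_ρ_mul_inv (A : TwistedRep K α) (x y : K) (v : A.V) :
    A.ρ y v = ((α (y * x⁻¹ : K) x)⁻¹ : kˣ).val • A.ρ (y * x⁻¹) (A.ρ x v) := by
  rw [ρ_ρ, smul_smul, Units.inv_mul, one_smul, inv_mul_cancel_right]

variable {hHK : H ≤ K} {V : TwistedRep K α} {A : TwistedRep H α}

/-- The intertwiner `v ↦ (x ↦ π (x v))` to the induced representation that corresponds to an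
intertwiner `π` of `H` by Frobenius reciprocity. -/
def toInd [Finite K] (hα : IsCocycleOn K α) (π : res hHK V ⟶ A) : V ⟶ ind hHK hα A where
  lin := (LinearMap.pi fun x => π.lin ∘ₗ V.ρ x).codRestrict (indSubmodule hHK A) fun v h x =>
    (π.comm h _).symm.trans <| (congrArg π.lin (V.ρ_ρ _ x v)).trans (π.lin.map_smul _ _)
  comm y v := Subtype.ext <| funext fun x =>
    (congrArg π.lin (V.ρ_ρ x y v)).trans (π.lin.map_smul _ _)

theorem apply_ρ_of_mul_inv_mem (π : res hHK V ⟶ A) (f : indSubmodule hHK A) {x y : K} {v : V.V}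
    (hx : π.lin (V.ρ x v) = f.1 x) (hy : (y * x⁻¹ : G) ∈ H) : π.lin (V.ρ y v) = f.1 y := by
  have hyx : Subgroup.inclusion hHK ⟨_, hy⟩ * x = y := Subtype.ext (inv_mul_cancel_right _ _)
  have hf := f.2 ⟨_, hy⟩ x
  rw [hyx, ← hx] at hf
  rw [V.ρ_eq_smul_ρ_mul_inv x y]
  refine (π.lin.map_smul _ _).trans ((congrArg _ ((π.comm ⟨_, hy⟩ _).trans hf)).trans ?_)
  exact inv_smul_smul (α (y * x⁻¹ : K) x) _

theorem apply_ρ_eq_zero (π : res hHK V ⟶ A) {x y : K} {v : V.V}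
    (hx : ∀ z : K, (z : G) ∉ H → π.lin (V.ρ z (V.ρ x v)) = 0) (hy : (y * x⁻¹ : G) ∉ H) :
    π.lin (V.ρ y v) = 0 := by
  rw [V.ρ_eq_smul_ρ_mul_inv x y]
  exact (π.lin.map_smul _ _).trans ((congrArg _ (hx (y * x⁻¹) hy)).trans (smul_zero _))

/-- A preimage of `f` is the sum over the right cosets `Hx` of the vectors `v` for which `x v` is a
lift of `f x`. -/
theorem exists_toInd_eq [Finite K] (hα : IsCocycleOn K α) (π : res hHK V ⟶ A)
    (W : Submodule k V.V) (hW : ∀ x v, V.ρ x v ∈ W → v ∈ W)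
    (hπ : ∀ a, ∃ v ∈ W, π.lin v = a ∧ ∀ x : K, (x : G) ∉ H → π.lin (V.ρ x v) = 0)
    (f : (ind hHK hα A).V) : ∃ v ∈ W, (toInd hα π).lin v = f := by
  classical
  let f' : indSubmodule hHK A := f
  choose w hwW hwf hw0 using fun x => hπ (f'.1 x)
  choose v hv using fun x => (V.ρ_bijective x).2 (w x)
  let cosets := QuotientGroup.rightRel (H.subgroupOf K)
  have mem_iff (x y : K) : (y * x⁻¹ : G) ∈ H ↔ cosets x y :=
    (QuotientGroup.rightRel_apply (s := H.subgroupOf K)).symm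
  have : Fintype (Quotient cosets) := Fintype.ofFinite _
  refine ⟨∑ c : Quotient cosets, v c.out,
    W.sum_mem fun c _ => hW c.out _ (hv c.out ▸ hwW _), Subtype.ext (funext fun y => ?_)⟩
  change π.lin (V.ρ y (∑ c : Quotient cosets, v c.out)) = f'.1 y
  rw [map_sum]
  refine (map_sum π.lin _ _).trans
    ((Finset.sum_eq_single (Quotient.mk _ y) (fun c _ hc => ?_)
      fun h => absurd (Finset.mem_univ _) h).trans ?_)
  · refine apply_ρ_eq_zero π (x := c.out) (fun z hz => hv c.out ▸ hw0 _ z hz) ?_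
    rw [mem_iff]
    exact fun h => hc ((Quotient.out_eq c).symm.trans (Quotient.sound h))
  · refine apply_ρ_of_mul_inv_mem π f' (x := (Quotient.mk cosets y).out)
      ((congrArg π.lin (hv _)).trans (hwf _)) ?_
    exact (mem_iff _ _).2 (Quotient.mk_out (s := cosets) y)

theorem piLift_toInd_bijective [Finite K] {ι : Type u} [Finite ι] {H : ι → Subgroup G}
    {hHK : ∀ i, H i ≤ K} (hα : IsCocycleOn K α) {A : ∀ i, TwistedRep (H i) α}
    (π : ∀ i, res (hHK i) V ⟶ A i)
    (jointly_injective : ∀ v, (∀ i x, (π i).lin (V.ρ x v) = 0) → v = 0)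
    (exists_lift : ∀ i a, ∃ v, (∀ j ≠ i, ∀ x, (π j).lin (V.ρ x v) = 0) ∧ (π i).lin v = a ∧
      ∀ x : K, (x : G) ∉ H i → (π i).lin (V.ρ x v) = 0) :
    Function.Bijective (piLift fun i => toInd hα (π i)).lin := by
  classical
  refine ⟨(injective_iff_map_eq_zero _).2 fun v hv => jointly_injective v fun i x =>
    congrFun (congrArg Subtype.val (congrFun hv i)) x, fun f => ?_⟩
  let W (i : ι) : Submodule k V.V :=
    ⨅ (j : ι) (_ : j ≠ i) (x : K), LinearMap.ker ((π j).lin ∘ₗ V.ρ x)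
  have mem_W {i : ι} {v : V.V} : v ∈ W i ↔ ∀ j ≠ i, ∀ x, (π j).lin (V.ρ x v) = 0 := by
    simp only [W, Submodule.mem_iInf]
    rfl
  have mem_of_ρ_mem (i : ι) (x : K) (v : V.V) (h : V.ρ x v ∈ W i) : v ∈ W i :=
    mem_W.2 fun j hj y => by
      rw [V.ρ_eq_smul_ρ_mul_inv x y]
      exact ((π j).lin.map_smul _ _).trans ((congrArg _ (mem_W.1 h j hj _)).trans (smul_zero _))
  choose u huW hu using fun i => exists_toInd_eq hα (π i) (W i) (mem_of_ρ_mem i)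
    (fun a => by simpa only [mem_W] using exists_lift i a) (f i)
  have : Fintype ι := Fintype.ofFinite ι
  refine ⟨∑ i, u i, funext fun i => ?_⟩
  refine (map_sum (toInd hα (π i)).lin u Finset.univ).trans
    ((Finset.sum_eq_single i (fun j _ hj => ?_) fun h => absurd (Finset.mem_univ _) h).trans (hu i))
  exact Subtype.ext (funext (mem_W.1 (huW j) i hj.symm))

end TwistedRep
end FrobeniusReciprocity

section BihomogeneousParts
variable {G k : Type u} [Group G] [Field k] [Fintype G] {β : NormalizedCocycle G k}

namespace RepDouble
open TwistedDouble

theorem degProj_φ (M : RepDouble β) {a m : G} (x : G) (hm : m = x * a * x⁻¹) (v : M.V) :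
    M.degProj m (M.φ x v) = (M.degConj x hm).lin (M.degProj a v) := by
  subst hm
  exact M.degIncl_injective _ (M.proj_φ a x v)

/-- The projection of a tensor product to the part of bidegree `(a, b)`. -/
noncomputable def bidegProj (M N : RepDouble β) (a b : G) :
    (M.tensor N).V →ₗ[k] (M.deg a).V ⊗[k] (N.deg b).V :=
  TensorProduct.map (M.degProj a) (N.degProj b)

/-- The inclusion of the part of bidegree `(a, b)` in a tensor product. -/
noncomputable def bidegIncl (M N : RepDouble β) (a b : G) :
    (M.deg a).V ⊗[k] (N.deg b).V →ₗ[k] (M.tensor N).V :=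
  TensorProduct.map (M.degIncl a) (N.degIncl b)

variable {M N : RepDouble β}

theorem bidegProj_tmul_eq_zero {a b c d : G} {u : M.V} {v : N.V} (hu : M.Homog c u)
    (hv : N.Homog d v) (h : ¬(a = c ∧ b = d)) : bidegProj M N a b (u ⊗ₜ[k] v) = 0 := by
  refine (TensorProduct.map_tmul _ _ u v).trans ?_
  by_cases hac : a = c
  · rw [degProj_eq_zero hv fun hbd => h ⟨hac, hbd⟩, TensorProduct.tmul_zero]
  · rw [degProj_eq_zero hu hac, TensorProduct.zero_tmul]

theorem bidegProj_bidegIncl {a b : G} (w : (M.deg a).V ⊗[k] (N.deg b).V) :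
    bidegProj M N a b (bidegIncl M N a b w) = w :=
  LinearMap.congr_fun (f := bidegProj M N a b ∘ₗ bidegIncl M N a b) (g := LinearMap.id)
    (TensorProduct.ext' fun u v =>
      congrArg₂ (· ⊗ₜ[k] ·) (M.degProj_degIncl u) (N.degProj_degIncl v)) w

theorem bidegProj_bidegIncl_eq_zero {a b c d : G} (h : ¬(a = c ∧ b = d))
    (w : (M.deg c).V ⊗[k] (N.deg d).V) : bidegProj M N a b (bidegIncl M N c d w) = 0 :=
  LinearMap.congr_fun (f := bidegProj M N a b ∘ₗ bidegIncl M N c d) (g := 0)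
    (TensorProduct.ext' fun u v =>
      bidegProj_tmul_eq_zero (M.homog_degIncl u) (N.homog_degIncl v) h) w

theorem homog_bidegIncl {a b : G} (w : (M.deg a).V ⊗[k] (N.deg b).V) :
    (M.tensor N).Homog (a * b) (bidegIncl M N a b w) :=
  LinearMap.congr_fun (f := (M.tensor N).ρ (elt β (a * b) 1) ∘ₗ bidegIncl M N a b)
    (g := bidegIncl M N a b)
    (TensorProduct.ext' fun u v => (M.homog_degIncl u).tensor (N.homog_degIncl v)) w

theorem bidegProj_eq_zero {a b g : G} {t : (M.tensor N).V} (ht : (M.tensor N).Homog g t)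
    (hab : a * b ≠ g) : bidegProj M N a b t = 0 := by
  classical
  rw [← ht]
  refine LinearMap.congr_fun (f := bidegProj M N a b ∘ₗ (M.tensor N).ρ (elt β g 1)) (g := 0)
    (lin_ext₂ fun c u d v hu hv => ?_) t
  rw [LinearMap.comp_apply, homog_proj_eq (hu.tensor hv), LinearMap.zero_apply]
  split_ifs with hg
  · exact bidegProj_tmul_eq_zero hu hv fun h => hab (by rw [h.1, h.2, hg])
  · exact map_zero _

theorem sum_bidegIncl_bidegProj (t : (M.tensor N).V) :
    ∑ a, ∑ b, bidegIncl M N a b (bidegProj M N a b t) = t := by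
  have sum_eq : ∑ a, ∑ b, bidegIncl M N a b ∘ₗ bidegProj M N a b = LinearMap.id :=
    TensorProduct.ext' fun u v => by
      simp only [LinearMap.sum_apply]
      change ∑ a, ∑ b, M.ρ (elt β a 1) u ⊗ₜ[k] N.ρ (elt β b 1) v = u ⊗ₜ v
      simp only [← TensorProduct.tmul_sum, ← TensorProduct.sum_tmul, sum_proj]
  have sum_eq_t := LinearMap.congr_fun sum_eq t
  simp only [LinearMap.sum_apply] at sum_eq_t
  exact sum_eq_t

theorem eq_zero_of_bidegProj {g : G} {t : (M.tensor N).V} (ht : (M.tensor N).Homog g t)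
    (h : ∀ a b, a * b = g → bidegProj M N a b t = 0) : t = 0 := by
  rw [← sum_bidegIncl_bidegProj t]
  refine Finset.sum_eq_zero fun a _ => Finset.sum_eq_zero fun b _ => ?_
  by_cases hab : a * b = g
  · rw [h a b hab, map_zero]
  · rw [bidegProj_eq_zero ht hab, map_zero]

theorem bidegProj_φ {a b a' b' : G} (x : G) (ha : a' = x * a * x⁻¹) (hb : b' = x * b * x⁻¹)
    (t : (M.tensor N).V) :
    bidegProj M N a' b' ((M.tensor N).φ x t) = (β.γ x a' b' : k) •
      TensorProduct.map (M.degConj x ha).lin (N.degConj x hb).lin (bidegProj M N a b t) := by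
  refine LinearMap.congr_fun (f := bidegProj M N a' b' ∘ₗ (M.tensor N).φ x)
    (g := (β.γ x a' b' : k) •
      TensorProduct.map (M.degConj x ha).lin (N.degConj x hb).lin ∘ₗ bidegProj M N a b)
    (lin_ext₂ fun c u d v hu hv => ?_) t
  rw [LinearMap.comp_apply, tensor_φ hu hv, map_smul]
  by_cases h : a = c ∧ b = d
  · obtain ⟨rfl, rfl⟩ := h
    subst ha hb
    exact congrArg (_ • ·) (congrArg₂ (· ⊗ₜ[k] ·) (M.degProj_φ x rfl u) (N.degProj_φ x rfl v))
  · rw [bidegProj_tmul_eq_zero (homog_φ hu x) (homog_φ hv x), smul_zero]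
    · exact Eq.symm <| smul_eq_zero_of_right (β.γ x a' b' : k) <|
        (congrArg (TensorProduct.map (M.degConj x ha).lin (N.degConj x hb).lin)
          (bidegProj_tmul_eq_zero hu hv h)).trans (map_zero _)
    · subst ha hb
      simpa only [mul_left_inj, mul_right_inj] using h

theorem bidegProj_φ_eq_zero_iff {a b a' b' : G} (x : G) (ha : a' = x * a * x⁻¹)
    (hb : b' = x * b * x⁻¹) (t : (M.tensor N).V) :
    bidegProj M N a' b' ((M.tensor N).φ x t) = 0 ↔ bidegProj M N a b t = 0 := by
  have injective := (TensorProduct.map_bijective (M.degConj_bijective x ha)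
    (N.degConj_bijective x hb)).1
  rw [bidegProj_φ x ha hb, smul_eq_zero_iff_right (Units.ne_zero _)]
  exact map_eq_zero_iff _ injective

end RepDouble
end BihomogeneousParts

section PushPull
variable {G k : Type u} [Group G] [Field k]

namespace Sector

theorem exists_conj {g a b : G} (hab : a * b = g) :
    ∃ (s : Sector g) (x : Subgroup.centralizer {g}),
      s.fst = x * a * (x : G)⁻¹ ∧ s.snd = x * b * (x : G)⁻¹ := by
  let s : Sector g := Quotient.mk _ ⟨(a, b), hab⟩
  obtain ⟨x, ha, hb⟩ := (pairSetoid g).symm (Quotient.mk_out (s := pairSetoid g) ⟨(a, b), hab⟩)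
  have hg : x * g * x⁻¹ = g := calc
    x * g * x⁻¹ = x * (a * b) * x⁻¹ := by rw [hab]
    _ = x * a * x⁻¹ * (x * b * x⁻¹) := conj_mul.symm
    _ = s.fst * s.snd := congrArg₂ (· * ·) ha hb
    _ = g := s.mul
  exact ⟨s, ⟨x, Subgroup.mem_centralizer_singleton_iff.2 (mul_inv_eq_iff_eq_mul.1 hg)⟩,
    ha.symm, hb.symm⟩

theorem eq_of_conj {g x : G} {s t : Sector g} (hfst : x⁻¹ * s.fst * x = t.fst)
    (hsnd : x⁻¹ * s.snd * x = t.snd) : s = t := by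
  rw [← Quotient.out_eq s, ← Quotient.out_eq t]
  exact Quotient.sound ⟨x⁻¹, by rwa [inv_inv], by rwa [inv_inv]⟩

theorem mem_centralizer_of_conj {a b x : G} (ha : x⁻¹ * a * x = a) (hb : x⁻¹ * b * x = b) :
    x ∈ Subgroup.centralizer {a, b} := by
  rw [Subgroup.mem_centralizer_iff]
  rintro m (rfl | rfl)
  · rwa [mul_assoc, inv_mul_eq_iff_eq_mul] at ha
  · rwa [mul_assoc, inv_mul_eq_iff_eq_mul] at hb

end Sector

variable [Fintype G] {β : NormalizedCocycle G k}

namespace RepDouble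
open TwistedDouble TwistedRep InertiaBundle

/-- The restriction of the bundle of `M` to the sector of `m` is the homogeneous part of degree
`m`. -/
noncomputable def atEltIso (M : RepDouble β) (m : G) : ((toBundle β).obj M).atElt m ≅ M.deg m :=
  TwistedRep.isoOfBijective (M.degConj (conjugator m) (conjugator_spec m)) (M.degConj_bijective _ _)

theorem degMap_atEltIso_inv {M N : RepDouble β} (f : M ⟶ N) (m : G) :
    degMap f m ≫ (N.atEltIso m).inv = (M.atEltIso m).inv ≫ atEltMap ((toBundle β).map f) m := by
  rw [Iso.comp_inv_eq, Category.assoc, Iso.eq_inv_comp]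
  exact degMap_degConj f _ _

/-- The projection of a tensor product to the part of bidegree `(a, b)`, as an intertwiner of
representations of the common centralizer. -/
noncomputable def resBidegProj (M N : RepDouble β) {a b g : G} (hab : a * b = g) :
    res (centralizer_pair_le_mul hab) ((M.tensor N).deg g) ⟶
      TwistedRep.tensor β hab (res (centralizer_pair_le_left a b) (M.deg a))
        (res (centralizer_pair_le_right a b) (N.deg b)) where
  lin := bidegProj M N a b ∘ₗ (M.tensor N).degIncl g
  comm z _ :=
    bidegProj_φ (z : G) (conj_eq_of_mem_centralizer (centralizer_pair_le_left a b z.2)).symm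
      (conj_eq_of_mem_centralizer (centralizer_pair_le_right a b z.2)).symm _

variable (M N : RepDouble β) {g : G} (s : Sector g)

/-- The identification of the part of bidegree `s` of a tensor product with the fibre over the
sector `s` of the product of the bundles. -/
noncomputable def sectorTensorIso :
    TwistedRep.tensor β s.mul (res (centralizer_pair_le_left s.fst s.snd) (M.deg s.fst))
      (res (centralizer_pair_le_right s.fst s.snd) (N.deg s.snd)) ≅
      ((toBundle β).obj M).sectorTensor ((toBundle β).obj N) s :=
  TwistedRep.isoOfBijective (tensorMap β s.mul (resMap _ (M.atEltIso s.fst).inv)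
    (resMap _ (N.atEltIso s.snd).inv))
    (TensorProduct.map_bijective (TwistedRep.linEquivOfIso (M.atEltIso s.fst)).symm.bijective
      (TwistedRep.linEquivOfIso (N.atEltIso s.snd)).symm.bijective)

/-- The projection of the tensor product of two modules to the fibre over a sector of the product of
their bundles. -/
noncomputable def sectorProj : res (centralizer_pair_le_mul s.mul) ((M.tensor N).deg g) ⟶
    ((toBundle β).obj M).sectorTensor ((toBundle β).obj N) s :=
  resBidegProj M N s.mul ≫ (sectorTensorIso M N s).hom

variable {M N}

theorem sectorProj_ρ_eq_zero_iff {a b : G} (x : Subgroup.centralizer {g})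
    (ha : s.fst = x * a * (x : G)⁻¹) (hb : s.snd = x * b * (x : G)⁻¹)
    (t : ((M.tensor N).deg g).V) :
    (sectorProj M N s).lin (((M.tensor N).deg g).ρ x t) = 0 ↔
      bidegProj M N a b ((M.tensor N).degIncl g t) = 0 :=
  (map_eq_zero_iff _ (TwistedRep.linEquivOfIso (sectorTensorIso M N s)).injective).trans
    (bidegProj_φ_eq_zero_iff (x : G) ha hb _)

theorem exists_sectorProj_eq (a : (((toBundle β).obj M).sectorTensor ((toBundle β).obj N) s).V) :
    ∃ t, (∀ r ≠ s, ∀ x, (sectorProj M N r).lin (((M.tensor N).deg g).ρ x t) = 0) ∧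
      (sectorProj M N s).lin t = a ∧ ∀ x : Subgroup.centralizer {g},
        (x : G) ∉ Subgroup.centralizer {s.fst, s.snd} →
          (sectorProj M N s).lin (((M.tensor N).deg g).ρ x t) = 0 := by
  let e := TwistedRep.linEquivOfIso (sectorTensorIso M N s)
  obtain ⟨w, rfl⟩ : ∃ w : (M.deg s.fst).V ⊗[k] (N.deg s.snd).V, e w = a := e.surjective a
  obtain ⟨t, ht⟩ := exists_degIncl_eq (M := M.tensor N) (g := g)
    (v := bidegIncl M N s.fst s.snd w) (by
      have h := homog_bidegIncl (M := M) (N := N) w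
      rwa [s.mul] at h)
  have sectorProj_eq_zero (r : Sector g) (x : Subgroup.centralizer {g})
      (h : ¬((x : G)⁻¹ * r.fst * x = s.fst ∧ (x : G)⁻¹ * r.snd * x = s.snd)) :
      (sectorProj M N r).lin (((M.tensor N).deg g).ρ x t) = 0 := by
    refine (sectorProj_ρ_eq_zero_iff r x (a := (x : G)⁻¹ * r.fst * x)
      (b := (x : G)⁻¹ * r.snd * x) (by group) (by group) t).2 ?_
    rw [ht, bidegProj_bidegIncl_eq_zero h]
  refine ⟨t, fun r hr x => sectorProj_eq_zero r x fun h => hr (Sector.eq_of_conj h.1 h.2), ?_,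
    fun x hx => sectorProj_eq_zero s x fun h => hx (Sector.mem_centralizer_of_conj h.1 h.2)⟩
  refine (congrArg (fun t => e (bidegProj M N s.fst s.snd t)) ht).trans ?_
  rw [bidegProj_bidegIncl]

variable (M N)

/-- The comparison of the tensor product of modules with the push-pull product of their bundles. -/
noncomputable def toPushPull :
    (toBundle β).obj (M.tensor N) ⟶ ((toBundle β).obj M).mul ((toBundle β).obj N) := fun c =>
  piLift fun s : Sector (classRep c) => toInd (β.θ_isCocycleOn (classRep c)) (sectorProj M N s)

theorem toPushPull_bijective (c : ConjClasses G) :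
    Function.Bijective (toPushPull M N c).lin := by
  refine piLift_toInd_bijective (β.θ_isCocycleOn (classRep c)) (fun s => sectorProj M N s)
    (fun t ht => ?_) fun s a => exists_sectorProj_eq s a
  apply (M.tensor N).degIncl_injective
  rw [map_zero]
  refine eq_zero_of_bidegProj ((M.tensor N).homog_degIncl t) fun a b hab => ?_
  obtain ⟨s, x, ha, hb⟩ := Sector.exists_conj hab
  exact (sectorProj_ρ_eq_zero_iff s x ha hb t).1 (ht s x)

variable {M N}

theorem degMap_tensorHom_sectorProj {M' N' : RepDouble β} (f : M ⟶ M') (f' : N ⟶ N') :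
    (sectorProj M' N' s).lin ∘ₗ (degMap (tensorHom f f') g).lin =
      (sectorTensorMap ((toBundle β).map f) ((toBundle β).map f') s).lin ∘ₗ
        (sectorProj M N s).lin := by
  refine LinearMap.ext fun t => ?_
  refine LinearMap.congr_fun
    (f := (sectorTensorIso M' N' s).hom.lin ∘ₗ bidegProj M' N' s.fst s.snd ∘ₗ (tensorHom f f').lin)
    (g := (sectorTensorMap ((toBundle β).map f) ((toBundle β).map f') s).lin ∘ₗ
      (sectorTensorIso M N s).hom.lin ∘ₗ bidegProj M N s.fst s.snd)
    (TensorProduct.ext' fun u v => ?_) ((M.tensor N).degIncl g t)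
  have natural {A B : RepDouble β} (f : A ⟶ B) (m : G) (v : A.V) :
      (B.atEltIso m).inv.lin (B.degProj m (f.lin v)) =
        (atEltMap ((toBundle β).map f) m).lin ((A.atEltIso m).inv.lin (A.degProj m v)) := by
    rw [← degMap_degProj]
    exact LinearMap.congr_fun (congrArg TwistedRep.Hom.lin (degMap_atEltIso_inv f m)) _
  exact congrArg₂ (· ⊗ₜ[k] ·) (natural f s.fst u) (natural f' s.snd v)

/-- The bundle of a tensor product of modules is the push-pull product of the bundles. -/
noncomputable def tensorPushPullIso (β : NormalizedCocycle G k) :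
    MonoidalCategory.tensor (RepDouble β) ⋙ toBundle β ≅
      (toBundle β).prod (toBundle β) ⋙ pushPull β :=
  NatIso.ofComponents (fun P => InertiaBundle.isoOfBijective (toPushPull P.1 P.2)
    (toPushPull_bijective P.1 P.2)) fun {P Q} f => funext fun c => TwistedRep.hom_ext <|
      LinearMap.ext fun t => funext fun s => Subtype.ext <| funext fun x => by
        refine (congrArg (sectorProj Q.1 Q.2 s).lin
          ((degMap (tensorHom f.1 f.2) (classRep c)).comm x t).symm).trans ?_
        exact LinearMap.congr_fun (degMap_tensorHom_sectorProj s f.1 f.2) _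

theorem unit_degIncl_bijective {g : G} (hg : g = 1) :
    Function.Bijective ((unit β).degIncl g) :=
  ⟨(unit β).degIncl_injective g, fun a => exists_degIncl_eq (hg ▸ homog_unit a)⟩

theorem subsingleton_unit_deg {g : G} (hg : g ≠ 1) : Subsingleton ((unit β).deg g).V := by
  classical
  refine subsingleton_of_forall_eq 0 fun v => (unit β).degIncl_injective g ?_
  rw [map_zero, ← (unit β).homog_degIncl v, homog_proj_eq (homog_unit _), if_neg hg]

theorem nonempty_unit_iso (β : NormalizedCocycle G k) :
    Nonempty ((toBundle β).obj (unit β) ≅ InertiaBundle.one β) := by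
  have h (c : ConjClasses G) : Nonempty ((toBundle β).obj (unit β) c ≅ InertiaBundle.one β c) := by
    unfold InertiaBundle.one
    by_cases hc : classRep c = 1
    · rw [dif_pos hc]
      exact ⟨TwistedRep.isoOfBijective ⟨(unit β).degIncl (classRep c), fun _ _ => unit_φ _ _⟩
        (unit_degIncl_bijective hc)⟩
    · rw [dif_neg hc]
      have : Subsingleton ((toBundle β).obj (unit β) c).V := subsingleton_unit_deg hc
      exact ⟨TwistedRep.isoOfBijective ⟨0, fun _ _ => rfl⟩
        ⟨Function.injective_of_subsingleton _, fun v => ⟨0, Subsingleton.elim _ _⟩⟩⟩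
  exact ⟨Pi.isoMk fun c => (h c).some⟩

end RepDouble
end PushPull

section GrothendieckRings

namespace GrothendieckGroup
variable {X Y : Type (u + 1)} {r : X → X → X → Prop} {s : Y → Y → Y → Prop}

theorem mk_eq_mk_of_exact {Z A B : X} (hA : r Z A A) (hB : r Z A B) : mk r A = mk r B :=
  add_left_cancel ((mk_eq hA).symm.trans (mk_eq hB))

/-- The isomorphism of Grothendieck groups that exact maps induce which are mutually inverse up to
equality of classes. -/
def congr (f : X → Y) (g : Y → X) (hf : ∀ A B C, r A B C → s (f A) (f B) (f C))
    (hg : ∀ A B C, s A B C → r (g A) (g B) (g C)) (hgf : ∀ A, mk r (g (f A)) = mk r A)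
    (hfg : ∀ B, mk s (f (g B)) = mk s B) : GrothendieckGroup r ≃+ GrothendieckGroup s :=
  AddMonoidHom.toAddEquiv (lift (fun A => mk s (f A)) fun A B C h => mk_eq (hf A B C h))
    (lift (fun B => mk r (g B)) fun A B C h => mk_eq (hg A B C h))
    (hom_ext fun A => by simp only [AddMonoidHom.comp_apply, lift_mk, hgf, AddMonoidHom.id_apply])
    (hom_ext fun B => by simp only [AddMonoidHom.comp_apply, lift_mk, hfg, AddMonoidHom.id_apply])

theorem congr_mk (f : X → Y) (g : Y → X) (hf : ∀ A B C, r A B C → s (f A) (f B) (f C))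
    (hg : ∀ A B C, s A B C → r (g A) (g B) (g C)) (hgf : ∀ A, mk r (g (f A)) = mk r A)
    (hfg : ∀ B, mk s (f (g B)) = mk s B) (A : X) :
    congr f g hf hg hgf hfg (mk r A) = mk s (f A) :=
  lift_mk (fun A => mk s (f A)) (fun A B C h => mk_eq (hf A B C h)) A

end GrothendieckGroup

variable {G k : Type u} [Group G] [Field k] {β : NormalizedCocycle G k}

theorem KFull.mk_eq_of_iso [Finite G] {A B : InertiaBundle β} (e : A ≅ B) :
    KFull.mk A = KFull.mk B := by
  have exact_of_iso {B : InertiaBundle β} (e : A ≅ B) :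
      InertiaBundle.ShortExact (fun _ => TwistedRep.zero) A B :=
    ⟨fun _ => ⟨0, fun _ _ => (map_zero _).symm⟩, e.hom, fun c => shortExactLin_iff_bijective.2
      (TwistedRep.linEquivOfIso (CategoryTheory.Pi.isoApp e c)).bijective⟩
  exact GrothendieckGroup.mk_eq_mk_of_exact (exact_of_iso (Iso.refl A)) (exact_of_iso e)

variable [Fintype G]

theorem RepRing.mk_eq_of_iso {A B : RepDouble β} (e : A ≅ B) : RepRing.mk A = RepRing.mk B := by
  have exact_of_iso {B : RepDouble β} (e : A ≅ B) : RepDouble.ShortExact RepDouble.zero A B :=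
    ⟨⟨0, fun _ _ => (map_zero _).symm⟩, e.hom, shortExactLin_iff_bijective.2
      (RepDouble.linEquivOfIso e).bijective⟩
  exact GrothendieckGroup.mk_eq_mk_of_exact (exact_of_iso (Iso.refl A)) (exact_of_iso e)

theorem RepDouble.ShortExact.toBundle {A B C : RepDouble β} (h : RepDouble.ShortExact A B C) :
    InertiaBundle.ShortExact ((toBundle β).obj A) ((toBundle β).obj B) ((toBundle β).obj C) := by
  obtain ⟨f, g, h⟩ := h
  exact ⟨(RepDouble.toBundle β).map f, (RepDouble.toBundle β).map g,
    (shortExactLin_iff_toBundle f g).1 h⟩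

theorem InertiaBundle.ShortExact.toDouble {A B C : InertiaBundle β}
    (h : InertiaBundle.ShortExact A B C) :
    RepDouble.ShortExact ((toDouble β).obj A) ((toDouble β).obj B) ((toDouble β).obj C) := by
  obtain ⟨f, g, h⟩ := h
  let e (F : InertiaBundle β) (c : ConjClasses G) :=
    TwistedRep.linEquivOfIso (CategoryTheory.Pi.isoApp ((counitIso β).app F) c)
  exact ⟨(InertiaBundle.toDouble β).map f, (InertiaBundle.toDouble β).map g,
    (RepDouble.shortExactLin_iff_toBundle _ _).2 fun c =>
      (shortExactLin_congr (e A c) (e B c) (e C c) rfl rfl).2 (h c)⟩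

open InertiaBundle RepDouble

/-- The module of a push-pull product is the tensor product of the modules. -/
noncomputable def toDoubleMulIso (F F' : InertiaBundle β) :
    (toDouble β).obj (F.mul F') ≅ (toDouble β).obj F ⊗ (toDouble β).obj F' :=
  (toDouble β).mapIso ((pushPull β).mapIso (Iso.prod ((counitIso β).app F).symm
    ((counitIso β).app F').symm) ≪≫ ((tensorPushPullIso β).app (_, _)).symm) ≪≫
    ((RepDouble.unitIso β).app _).symm

/-- The additive isomorphism of the twisted full K-theory with the representation ring. -/
noncomputable def kFullAddEquiv (β : NormalizedCocycle G k) : KFull β ≃+ RepRing β :=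
  GrothendieckGroup.congr (toDouble β).obj (toBundle β).obj (fun _ _ _ h => h.toDouble)
    (fun _ _ _ h => h.toBundle) (fun F => KFull.mk_eq_of_iso ((counitIso β).app F))
    fun M => RepRing.mk_eq_of_iso ((RepDouble.unitIso β).app M).symm

theorem kFullAddEquiv_mk (F : InertiaBundle β) :
    kFullAddEquiv β (KFull.mk F) = RepRing.mk ((toDouble β).obj F) :=
  GrothendieckGroup.congr_mk _ _ _ _ _ _ F

theorem kFullAddEquiv_mul (a b : KFull β) :
    kFullAddEquiv β (a * b) = kFullAddEquiv β a * kFullAddEquiv β b := by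
  let Ψ : KFull β →+ RepRing β := kFullAddEquiv β
  have hΨ (F F' : InertiaBundle β) :
      Ψ (KFull.mk F * KFull.mk F') = Ψ (KFull.mk F) * Ψ (KFull.mk F') := by
    simp only [Ψ, AddMonoidHom.coe_coe, KFull.mk_mul, kFullAddEquiv_mk, RepRing.mk_mul]
    exact RepRing.mk_eq_of_iso (toDoubleMulIso F F')
  have h : AddMonoidHom.mul.compr₂ Ψ = (AddMonoidHom.mul.comp Ψ).compl₂ Ψ :=
    GrothendieckGroup.hom_ext fun F => GrothendieckGroup.hom_ext fun F' => hΨ F F'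
  exact DFunLike.congr_fun (DFunLike.congr_fun h a) b

/-- The twisted full K-theory is the representation ring of the twisted double. -/
noncomputable def kFullEquiv (β : NormalizedCocycle G k) : KFull β ≃+* RepRing β :=
  { kFullAddEquiv β with map_mul' := kFullAddEquiv_mul }

theorem kFullEquiv_mk (F : InertiaBundle β) :
    kFullEquiv β (KFull.mk F) = RepRing.mk ((toDouble β).obj F) :=
  kFullAddEquiv_mk F

theorem kFullEquiv_one (β : NormalizedCocycle G k) : kFullEquiv β 1 = 1 :=
  (kFullEquiv_mk _).trans (RepRing.mk_eq_of_iso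
    ((toDouble β).mapIso (nonempty_unit_iso β).some.symm ≪≫ ((RepDouble.unitIso β).app _).symm))

end GrothendieckRings

section RegularModule
variable {G k : Type u} [Group G] [Fintype G] [Field k]

namespace RepDouble
open TwistedDouble

/-- The regular module of the twisted double. -/
noncomputable def regular (β : NormalizedCocycle G k) : RepDouble β where
  V := TwistedDouble β
  finiteDimensional := Module.Finite.of_basis (basis β)
  ρ := Algebra.lmul k (TwistedDouble β)

theorem homog_regular (β : NormalizedCocycle G k) (g : G) : (regular β).Homog g (elt β g 1) := by
  classical
  refine (elt_mul_elt β g 1 g 1).trans ?_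
  simp only [one_mul, inv_one, mul_one, if_true, NormalizedCocycle.θ_one_left, Units.val_one,
    one_smul]

theorem assocLin_eq_iff (β : NormalizedCocycle G k) :
    (∀ (U V W : RepDouble β) (u : U.V) (v : V.V) (w : W.V),
      assocLin U V W ((u ⊗ₜ[k] v) ⊗ₜ[k] w) = u ⊗ₜ[k] (v ⊗ₜ[k] w)) ↔
      ∀ g h l, β.toFun g h l = 1 := by
  refine ⟨fun assoc_eq g h l => ?_, fun hβ U V W u v w => ?_⟩
  · have eq_smul := (assoc_eq (regular β) (regular β) (regular β) (elt β g 1) (elt β h 1)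
      (elt β l 1)).symm.trans
        (assocLin_homog (homog_regular β g) (homog_regular β h) (homog_regular β l))
    have tmul_ne_zero : elt β g 1 ⊗ₜ[k] (elt β h 1 ⊗ₜ[k] elt β l 1) ≠ 0 := by
      simpa only [elt, Module.Basis.tensorProduct_apply] using
        ((basis β).tensorProduct ((basis β).tensorProduct (basis β))).ne_zero
          ((g, 1), (h, 1), (l, 1))
    have inv_eq : ((β.toFun g h l)⁻¹ : kˣ).val = 1 :=
      smul_left_injective k tmul_ne_zero (eq_smul.symm.trans (one_smul k _).symm)
    exact inv_eq_one.1 (Units.val_eq_one.1 inv_eq)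
  · have assoc_eq : assocLin U V W = (TensorProduct.assoc k U.V V.V W.V).toLinearMap :=
      lin_ext₃ fun g u h v l w hu hv hw => by
        rw [assocLin_homog hu hv hw, hβ, inv_one, Units.val_one, one_smul]
        rfl
    exact LinearMap.congr_fun assoc_eq _

end RepDouble
end RegularModule

theorem mainTheorem2 {G k : Type u} [Group G] [Fintype G] [Field k] (β : NormalizedCocycle G k) :
    (∃ (_ : MonoidalCategory (InertiaBundle β)) (_ : BraidedCategory (InertiaBundle β))
      (E : InertiaBundle β ≌ RepDouble β) (_ : E.functor.Braided),
      Nonempty (MonoidalCategory.tensor (InertiaBundle β) ≅ InertiaBundle.pushPull β) ∧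
      Nonempty (𝟙_ (InertiaBundle β) ≅ InertiaBundle.one β) ∧
      (∀ (F F' : InertiaBundle β) (a : k) (f f' : F ⟶ F'), (∀ c, (f' c).lin = a • (f c).lin) →
        (E.functor.map f').lin = a • (E.functor.map f).lin) ∧
      ∃ Ψ : KFull β ≃+* RepRing β,
        Ψ 1 = 1 ∧ ∀ F, Ψ (KFull.mk F) = RepRing.mk (E.functor.obj F)) ∧
    (∀ (U V W : RepDouble β) (g h l : G) (u : U.V) (v : V.V) (w : W.V),
      U.Homog g u → V.Homog h v → W.Homog l w →
      (α_ U V W).hom.lin ((u ⊗ₜ[k] v) ⊗ₜ[k] w) =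
        ((β.toFun g h l)⁻¹ : kˣ).val • (u ⊗ₜ[k] (v ⊗ₜ[k] w))) ∧
    (∀ (U V : RepDouble β) (g : G) (u : U.V) (v : V.V), U.Homog g u →
      (β_ U V).hom.lin (u ⊗ₜ[k] v) = V.φ g v ⊗ₜ[k] u) ∧
    ((∀ (U V W : RepDouble β) (u : U.V) (v : V.V) (w : W.V),
      (α_ U V W).hom.lin ((u ⊗ₜ[k] v) ⊗ₜ[k] w) = u ⊗ₜ[k] (v ⊗ₜ[k] w)) ↔
      ∀ g h l, β.toFun g h l = 1) := by
  refine ⟨?_, fun U V W g h l u v w hu hv hw => RepDouble.assocLin_homog hu hv hw,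
    fun U V g u v hu => RepDouble.braidLin_homog hu v, RepDouble.assocLin_eq_iff β⟩
  let e := (bundleEquivalence β).symm
  refine ⟨Monoidal.Transported.instMonoidalCategory e, Monoidal.Transported.instBraidedCategory e,
    bundleEquivalence β, (inferInstance : (Monoidal.equivalenceTransported e).inverse.Braided),
    ⟨?tensorIso⟩, RepDouble.nonempty_unit_iso β, ?linear, kFullEquiv β, kFullEquiv_one β,
    kFullEquiv_mk⟩
  case tensorIso =>
    exact Functor.isoWhiskerLeft ((InertiaBundle.toDouble β).prod (InertiaBundle.toDouble β))
      (RepDouble.tensorPushPullIso β) ≪≫ Functor.isoWhiskerRight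
        (NatIso.prod (InertiaBundle.counitIso β) (InertiaBundle.counitIso β))
        (InertiaBundle.pushPull β)
  case linear => exact fun F F' a f f' => InertiaBundle.toDouble_map_smul a f f'
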